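/- **Games.** Let $G=(V,E)$ be a finite game graph, $V=V_0\uplus V_1$ non-empty, $E\subseteq V\times V$, in which every node has an outgoing edge; $E(v)$ is the set of outgoing edges of $v$, and $E_0$ the set of edges with source in $V_0$. Let $w:E\to[-W;W]$ be integer weights, $W\in\mathbb N$, and $T\subseteq V$. Plays are infinite paths; $w(\rho[0;i])$ is the sum of the first $i$ weights of $\rho$. The mean-payoff objective $\mathrm{MP}(w)$ is $\limsup_{i\to\infty}\frac1i w(\rho[0;i])\ge 0$; the objective $\mathrm{coB\ddot uchi}(T)$ is that every node visited infinitely often lies in $T$. A (Player 0) strategy maps every history ending in a node $v\in V_0$ to an edge of $E(v)$; it is winning from $v$ for an objective if all plays from $v$ that follow it satisfy the objective. **Templates.** A QaSTel $\Pi$ assigns to a node $u$ and a credit $c\in\mathbb N\cup\{\infty\}$ a set $\Pi(u,c)\subseteq E(u)$, monotone in $c$, with $\Pi(u,c)=\emptyset$ for $c<0$; $act_\Pi(e)$ is the least credit from which on $e$ is active, and $\mathtt{minEdges}(v)$ is the set of edges of $E(v)$ with least $act_\Pi$. A $(\Pi,c)$-play is a play $v_0v_1\dots$ such that either $(v_i,v_{i+1})\in\Pi(v_i,c+w(\rho[0;i]))$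 for all $i$ with $v_i\in V_0$, or, for some $k\ge0$, this holds for all $i<k$ with $v_i\in V_0$ while $v_k\in V_0$ and $\Pi(v_k,c+w(\rho[0;k]))=\emptyset$. A mixed template is $\Lambda=(S,D,\Pi)$ with $S,D\subseteq E_0$ (unsafe and co-live edges). A strategy follows $\Lambda$ if its plays never use an edge of $S$, use no edge of $D$ infinitely often, and if for some $c\ge W\cdot|V|$ all its plays (from all nodes) are $(\Pi,c)$-plays. $\Lambda$ is conflict-free if $\mathtt{minEdges}(v)\not\subseteq S\cup D$ for all $v\in V$, and winning from $\mathcal W\subseteq V$ if every strategy following $\Lambda$ is winning from every $v\in\mathcal W$ both for $\mathrm{MP}(w)$ and for $\mathrm{coB\ddot uchi}(T)$. **Algorithm.** $\textsc{coB\"uchiTemp}(U)$, for the objective $\mathrm{coB\ddot uchi}(T)\wedge\mathrm{Safety}(U)$ (stay in $U$): compute its winning region $Z$ (discard the nodes from which Player 0 cannot stay in $U$; in the remaining subgame repeatedly remove Player 0's attractor to the set of nodes from which she can stay in $T$ forever, until this set is empty; $Z$ consists of the removed nodes). Let $S$ be the set of Player 0's edges from $Z$ to $V\setminus Z$. Put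 $R:=Z$, $D:=\emptyset$, and while $R\ne\emptyset$: let $A$ be the set of nodes from which Player 0 can stay in $T\cap R$ forever in the subgame on $R$; add Player 0's edges from $A$ to $R\setminus A$ to $D$; while the set $B$ of nodes of $R\setminus A$ from which Player 0 can force the play into $A$ in one step of the subgame on $R$ is non-empty, add Player 0's edges from $B$ to $R\setminus A$ to $D$ and replace $A$ by $A\cup B$; then replace $R$ by $R\setminus A$. Return $(Z,S,D)$. $\textsc{computeQaSTel}(\mu_{in})$, for $\mu_{in}:E\to\mathbb N\cup\{\infty\}$: starting from $\mu_{in}$, raise values $\mu(e)$, $e=(u,v)$, to $\min_{e'\in E(v)}(\mu(e')\ominus w(e))$ if $v\in V_0$, resp. to $\max_{e'\in E(v)}(\mu(e')\ominus w(e))$ if $v\in V_1$, whenever this is larger than $\mu(e)$, until nothing changes; here $l\ominus z=\max(l-z,0)$, and values above $|V|\cdot W$ are replaced by $\infty$. (This is implemented with a stack of nodes whose value has to be propagated and, at each node of $V_0$, a counter of the edges attaining its minimum.) Return $\mu$, representing the QaSTel $\Pi(u,k)=\{e\in E(u)\mid k\ge\mu(e)\}$, and the set of nodes $v\in V_0$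 with some, and $v\in V_1$ with only, outgoing edges of finite value. $\textsc{computeMiSTel}$: let $(Z,S,D)$ be computed by $\textsc{coB\"uchiTemp}(V)$ and $(\mathcal W_\varphi,\mu)$ by $\textsc{computeQaSTel}(0)$; let $\mathcal W=Z\cap\mathcal W_\varphi$, and let the set $\mathcal C$ of conflicts be the union of the sets $\mathtt{minEdges}(v)$ with $v\in\mathcal W$ and $\mathtt{minEdges}(v)\subseteq S\cup D$. While $\mathcal C\neq\emptyset$: add the requirement $\mathrm{Safety}(\mathcal W)$ to the co-Büchi objective, set $\mu(e)=\infty$ for all $e\in\mathcal C$, recompute $(Z,S,D)$ (only if the objective has changed) and $(\mathcal W_\varphi,\mu)$ (starting from the current $\mu$), and then $\mathcal W$ and $\mathcal C$. Return $\mathcal W$ and $\Lambda=(S,D,\Pi)$ with $\Pi$ given by $\mu$. **Statement.** For every mean-payoff co-Büchi game as above, $\textsc{computeMiSTel}$ terminates, and its output $(\mathcal W,\Lambda)$ is such that $\Lambda$ is a conflict-free mixed template that is winning from $\mathcal W$. Moreover, its running time (number of elementary steps in the unit-cost model, the graph being given by successor and predecessor lists) is $\mathcal O(n^2m+nmW)$,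 where $n=|V|$ and $m=|E|$, with a constant that does not depend on the game. -/

import Mathlib

open Filter

namespace MixedGame

/-! ## Game graphs, plays, strategies, objectives -/

/-- A two-player game graph on the node set `V`: `V0` is the set of nodes of Player 0, all other
nodes belong to Player 1, and `edges` is the edge relation. -/
structure GameGraph (V : Type) where
  V0 : Finset V
  edges : Finset (V × V)

namespace GameGraph

variable {V : Type} [DecidableEq V]

/-- The set `E(v)` of outgoing edges of `v`. -/
def out (G : GameGraph V) (v : V) : Finset (V × V) := G.edges.filter fun e => e.1 = v

/-- The set `E₀` of edges whose source belongs to Player 0. -/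
def edges0 (G : GameGraph V) : Finset (V × V) := G.edges.filter fun e => e.1 ∈ G.V0

/-- Plays are infinite paths. -/
def IsPlay (G : GameGraph V) (ρ : ℕ → V) : Prop := ∀ i, (ρ i, ρ (i + 1)) ∈ G.edges

end GameGraph

/-- A strategy of Player 0: it maps a history `H · v` that ends in a node `v` of Player 0 to an
outgoing edge of `v`. -/
structure Strategy {V : Type} [DecidableEq V] (G : GameGraph V) where
  move : List V → {v : V // v ∈ G.V0} → V × V
  move_mem : ∀ H v, move H v ∈ G.out v.1

/-- `ρ` is a `π`-play: every move from a node of Player 0 is the one that `π` prescribes for the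
history seen so far. -/
def Strategy.IsPlay {V : Type} [DecidableEq V] {G : GameGraph V} (π : Strategy G)
    (ρ : ℕ → V) : Prop :=
  G.IsPlay ρ ∧
    ∀ (j : ℕ) (h : ρ j ∈ G.V0), π.move ((List.range j).map ρ) ⟨ρ j, h⟩ = (ρ j, ρ (j + 1))

/-- `π` is winning from `v` for the objective `φ`. -/
def Strategy.WinsFrom {V : Type} [DecidableEq V] {G : GameGraph V} (π : Strategy G)
    (φ : Set (ℕ → V)) (v : V) : Prop :=
  ∀ ρ, π.IsPlay ρ → ρ 0 = v → ρ ∈ φ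

/-- The weight `w(ρ[0;i])` of the prefix with `i` edges. -/
def prefixWeight {V : Type} (w : V × V → ℤ) (ρ : ℕ → V) (i : ℕ) : ℤ :=
  ∑ j ∈ Finset.range i, w (ρ j, ρ (j + 1))

/-- The mean-payoff objective (threshold `0`, limit superior of the average weights). -/
def meanPayoff {V : Type} (w : V × V → ℤ) : Set (ℕ → V) :=
  {ρ | 0 ≤ limsup (fun i : ℕ => (((prefixWeight w ρ i : ℝ) / (i : ℝ) : ℝ) : EReal)) atTop}

/-- The co-Büchi objective: every node seen infinitely often lies in `T`. -/
def coBuchi {V : Type} (T : Finset V) : Set (ℕ → V) :=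
  {ρ | ∀ v, (∃ᶠ i in atTop, ρ i = v) → v ∈ T}

/-! ## Strategy templates -/

/-- A quantitative strategy template: the edges of a node that a credit in `ℕ∞` activates. Only
its values at nodes of Player 0 constrain plays. -/
structure QaSTel {V : Type} [DecidableEq V] (G : GameGraph V) where
  active : V → ℕ∞ → Finset (V × V)
  active_subset : ∀ u c, active u c ⊆ G.out u
  active_mono : ∀ u c c', c ≤ c' → active u c ⊆ active u c'

namespace QaSTel

variable {V : Type} [DecidableEq V] {G : GameGraph V}

/-- The extension to integer credits: a negative credit activates nothing. -/
def activeInt (P : QaSTel G) (u : V) (c : ℤ) : Finset (V × V) :=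
  if 0 ≤ c then P.active u (c.toNat : ℕ∞) else ∅

/-- The activation value of an edge `e`: the least `k` such that every credit in `[k; ∞]`
activates `e`. -/
noncomputable def act (P : QaSTel G) (e : V × V) : ℕ∞ :=
  sInf {k : ℕ∞ | ∀ k', k ≤ k' → e ∈ P.active e.1 k'}

/-- The outgoing edges of `v` with the least activation value. -/
def minEdges (P : QaSTel G) (v : V) : Set (V × V) :=
  {e | e ∈ G.out v ∧ ∀ e' ∈ G.out v, P.act e ≤ P.act e'}

/-- `(P, c)`-plays: either Player 0 uses active edges only, forever (`k = ∞`), or she does so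
until the play reaches (at position `k`) a node of hers with no active edge, from where on it
continues arbitrarily. -/
def IsPlay (P : QaSTel G) (w : V × V → ℤ) (c : ℕ) (ρ : ℕ → V) : Prop :=
  G.IsPlay ρ ∧ ∃ k : ℕ∞,
    (∀ i : ℕ, (i : ℕ∞) < k → ρ i ∈ G.V0 →
      (ρ i, ρ (i + 1)) ∈ P.activeInt (ρ i) (c + prefixWeight w ρ i)) ∧
    (∀ j : ℕ, k = (j : ℕ∞) →
      ρ j ∈ G.V0 ∧ P.activeInt (ρ j) (c + prefixWeight w ρ j) = ∅)

/-- The template extracted from an edge function `μ`: a credit `k` activates the edges `e` with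
`k ≥ μ e`. -/
def ofValue (G : GameGraph V) (μ : V × V → ℕ∞) : QaSTel G where
  active u k := (G.out u).filter fun e => μ e ≤ k
  active_subset _ _ := Finset.filter_subset _ _
  active_mono _ _ _ h e he := by
    rw [Finset.mem_filter] at he ⊢
    exact ⟨he.1, he.2.trans h⟩

end QaSTel

/-- A mixed strategy template: unsafe edges `S`, co-live edges `D` and a quantitative template. -/
structure MiSTel {V : Type} [DecidableEq V] (G : GameGraph V) where
  S : Finset (V × V)
  D : Finset (V × V)
  quant : QaSTel G

/-- `π` follows the quantitative template `P` in the mean-payoff game with weights in `[-W; W]`: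
for some credit `c ≥ W · |V|`, all `π`-plays are `(P, c)`-plays. -/
def Strategy.FollowsQaSTel {V : Type} [DecidableEq V] [Fintype V] {G : GameGraph V}
    (π : Strategy G) (w : V × V → ℤ) (W : ℕ) (P : QaSTel G) : Prop :=
  ∃ c : ℕ, W * Fintype.card V ≤ c ∧ ∀ ρ, π.IsPlay ρ → P.IsPlay w c ρ

/-- `π` follows the bounded qualitative template `(S, D)`: its plays never use an edge of `S` and
use no edge of `D` infinitely often. -/
def Strategy.FollowsPeSTel {V : Type} [DecidableEq V] {G : GameGraph V}
    (π : Strategy G) (S D : Finset (V × V)) : Prop :=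
  ∀ ρ, π.IsPlay ρ →
    (∀ e ∈ S, ∀ i, (ρ i, ρ (i + 1)) ≠ e) ∧
    (∀ e ∈ D, ¬ ∃ᶠ i in atTop, (ρ i, ρ (i + 1)) = e)

namespace MiSTel

variable {V : Type} [DecidableEq V] {G : GameGraph V}

/-- The edges constrained by the qualitative part belong to Player 0. -/
def IsValid (L : MiSTel G) : Prop := L.S ⊆ G.edges0 ∧ L.D ⊆ G.edges0

/-- At every node, some edge of least activation value is neither unsafe nor co-live. -/
def ConflictFree (L : MiSTel G) : Prop :=
  ∀ v : V, ¬ L.quant.minEdges v ⊆ (L.S ∪ L.D : Finset (V × V))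

/-- Every strategy that follows the template wins both the mean-payoff game and the co-Büchi game
from every node of `R`. -/
def WinningFrom [Fintype V] (L : MiSTel G) (w : V × V → ℤ) (W : ℕ) (T R : Finset V) : Prop :=
  ∀ v ∈ R, ∀ π : Strategy G,
    π.FollowsPeSTel L.S L.D → π.FollowsQaSTel w W L.quant →
      π.WinsFrom (meanPayoff w) v ∧ π.WinsFrom (coBuchi T) v

end MiSTel

/-! ## Computations with a step count

The cost model is the usual unit-cost one. The game graph is given by the list of its nodes and,
for each node, the lists of its successors and of its predecessors. Functions on nodes or edges are
arrays, finite sets of nodes or edges are bit arrays stored together with their cardinality, and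
the numbers are weights, counters bounded by `|V|` and values in `{0, …, |V| · W, ∞}`. One step
is a constant number of array accesses (read or write one entry), membership tests, insertions of
one element, emptiness tests, stack operations, comparisons and additions. Steps are counted by
the two loop constructs: one step for each execution of a loop body (in addition to the steps of
the loops nested in it) and one step for leaving the loop. All bulk operations are loops. -/

/-- A computation: `run = some (a, t)` if it returns `a` after `t` steps, `run = none` if it
diverges. -/
@[ext]
structure Comp (α : Type) where
  run : Option (α × ℕ)

instance : Monad Comp where
  pure a := ⟨some (a, 0)⟩
  bind x f := ⟨x.run.bind fun p => (f p.1).run.map fun q => (q.1, p.2 + q.2)⟩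

/-- Count one step. -/
def tick : Comp Unit := ⟨some ((), 1)⟩

theorem Comp.run_pure {α : Type} (a : α) : (pure a : Comp α).run = some (a, 0) := rfl

theorem Comp.run_bind {α β : Type} (x : Comp α) (f : α → Comp β) :
    (x >>= f).run = x.run.bind fun p => (f p.1).run.map fun q => (q.1, p.2 + q.2) := rfl

theorem Comp.run_tick_bind {β : Type} (f : Unit → Comp β) :
    (tick >>= f).run = (f ()).run.map fun q => (q.1, 1 + q.2) := rfl

/-- Run `body` on the elements of a list, one after the other. -/
def forEach {ι σ : Type} (l : List ι) (s : σ) (body : σ → ι → Comp σ) : Comp σ :=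
  match l with
  | [] => do
    tick
    return s
  | i :: l => do
    tick
    let s' ← body s i
    forEach l s' body

/-- Run `body` as long as the test `c` succeeds, but give up (`none`) if the loop is not left after
fewer than `n` rounds. -/
def whileFuel {σ : Type} (c : σ → Bool) (body : σ → Comp σ) : ℕ → σ → Comp σ
  | 0, _ => ⟨none⟩
  | n + 1, s =>
    if c s then do
      tick
      let s' ← body s
      whileFuel c body n s'
    else do
      tick
      return s

open Classical in
/-- Run `body` as long as the test `c` succeeds; diverges if the loop is never left. -/
noncomputable def whileLoop {σ : Type} (c : σ → Bool) (body : σ → Comp σ) (s : σ) : Comp σ :=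
  if h : ∃ n, (whileFuel c body n s).run ≠ none then whileFuel c body (Nat.find h) s else ⟨none⟩

theorem whileFuel_succ {σ : Type} (c : σ → Bool) (body : σ → Comp σ) (n : ℕ) (s : σ) :
    whileFuel c body (n + 1) s =
      if c s then tick >>= fun _ => body s >>= whileFuel c body n
      else tick >>= fun _ => pure s := rfl

theorem whileFuel_mono {σ : Type} (c : σ → Bool) (body : σ → Comp σ) (n : ℕ) :
    ∀ s : σ, (whileFuel c body n s).run ≠ none →
      whileFuel c body (n + 1) s = whileFuel c body n s := by
  induction n with
  | zero => exact fun _ h => absurd rfl h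
  | succ n ih =>
    intro s h
    rw [whileFuel_succ] at h
    rw [whileFuel_succ, whileFuel_succ c body n]
    by_cases hc : c s = true
    · rw [if_pos hc] at h ⊢
      rw [if_pos hc]
      ext1
      rw [Comp.run_tick_bind, Comp.run_bind] at h ⊢
      rw [Comp.run_tick_bind, Comp.run_bind]
      cases hb : (body s).run with
      | none => rfl
      | some p =>
        rw [hb] at h
        have h' : (whileFuel c body n p.1).run ≠ none := by
          intro h0
          apply h
          simp [h0]
        simp [ih p.1 h']
    · rw [if_neg hc, if_neg hc]

theorem whileLoop_eq_whileFuel {σ : Type} (c : σ → Bool) (body : σ → Comp σ) (n : ℕ) (s : σ)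
    (h : (whileFuel c body n s).run ≠ none) : whileLoop c body s = whileFuel c body n s := by
  classical
  have hex : ∃ n, (whileFuel c body n s).run ≠ none := ⟨n, h⟩
  rw [whileLoop, dif_pos hex]
  obtain ⟨d, hd⟩ := Nat.exists_eq_add_of_le (Nat.find_min' hex h)
  have key : ∀ d, whileFuel c body (Nat.find hex + d) s = whileFuel c body (Nat.find hex) s := by
    intro d
    induction d with
    | zero => rfl
    | succ d ih =>
      rw [← ih, ← Nat.add_assoc]
      refine whileFuel_mono c body _ s ?_
      rw [ih]
      exact Nat.find_spec hex
  rw [hd]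
  convert (key d).symm

/-- The defining recursion of the loop. -/
theorem whileLoop_unfold {σ : Type} (c : σ → Bool) (body : σ → Comp σ) (s : σ) :
    whileLoop c body s =
      if c s then tick >>= fun _ => body s >>= whileLoop c body
      else tick >>= fun _ => pure s := by
  by_cases hc : c s = true
  · rw [if_pos hc]
    have step : ∀ n, (whileFuel c body (n + 1) s).run =
        ((body s).run.bind fun p => (whileFuel c body n p.1).run.map
          fun q => (q.1, p.2 + q.2)).map fun q => (q.1, 1 + q.2) := by
      intro n
      rw [whileFuel_succ, if_pos hc, Comp.run_tick_bind, Comp.run_bind]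
    ext1
    rw [Comp.run_tick_bind, Comp.run_bind]
    by_cases hs : ∃ n, (whileFuel c body n s).run ≠ none
    · obtain ⟨n, hn⟩ := hs
      cases n with
      | zero => exact absurd rfl hn
      | succ n =>
        rw [whileLoop_eq_whileFuel c body _ _ hn, step]
        rw [step] at hn
        cases hb : (body s).run with
        | none => rfl
        | some p =>
          rw [hb] at hn
          have h' : (whileFuel c body n p.1).run ≠ none := by
            intro h0
            apply hn
            simp [h0]
          simp [whileLoop_eq_whileFuel c body n p.1 h']
    · have h0 : (whileLoop c body s).run = none := by rw [whileLoop, dif_neg hs]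
      rw [h0]
      cases hb : (body s).run with
      | none => rfl
      | some p =>
        have h1 : ¬ ∃ n, (whileFuel c body n p.1).run ≠ none := by
          rintro ⟨n, hn⟩
          refine hs ⟨n + 1, ?_⟩
          rw [step, hb]
          intro h2
          apply hn
          simpa using h2
        have h2 : (whileLoop c body p.1).run = none := by rw [whileLoop, dif_neg h1]
        simp [h2]
  · rw [if_neg hc]
    have h1 : whileFuel c body 1 s = tick >>= fun _ => pure s := by
      rw [whileFuel_succ, if_neg hc]
    rw [whileLoop_eq_whileFuel c body 1 s (by rw [h1]; exact Option.some_ne_none _), h1]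

section Algorithms

variable {V : Type} [Fintype V] [LinearOrder V]

/-- The list of all nodes. -/
def nodes (V : Type) [Fintype V] [LinearOrder V] : List V := (Finset.univ : Finset V).sort (· ≤ ·)

/-- The list of successors of a node. -/
def GameGraph.succ (G : GameGraph V) (u : V) : List V :=
  ((Finset.univ : Finset V).filter fun v => (u, v) ∈ G.edges).sort (· ≤ ·)

/-- The list of predecessors of a node. -/
def GameGraph.pred (G : GameGraph V) (v : V) : List V :=
  ((Finset.univ : Finset V).filter fun u => (u, v) ∈ G.edges).sort (· ≤ ·)

/-- The set of the nodes that pass a (constant-time) test. -/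
def nodesWhere (p : V → Bool) : Comp (Finset V) :=
  forEach (nodes V) ∅ fun A v => pure (if p v then insert v A else A)

/-- Add to `F` all edges that pass a (constant-time) test. -/
def addEdges (G : GameGraph V) (F : Finset (V × V)) (p : V → V → Bool) :
    Comp (Finset (V × V)) :=
  forEach (nodes V) F fun F u => forEach (G.succ u) F fun F v =>
    pure (if p u v then insert (u, v) F else F)

/-! ### Qualitative part: the co-Büchi template -/

/-- State of the attractor computation: the nodes attracted so far, for each node the number of its
successors in the subgame from which no attraction has been propagated yet, and the stack of
attracted nodes still to be propagated. -/
structure AttrState (V : Type) where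
  set : Finset V
  cnt : V → ℕ
  stack : List V

/-- The attractor of the set `U ⊆ R` in the subgame on `R`, for the player who owns the nodes
`mine`: the nodes of `R` from which that player can force the play to reach `U`. -/
noncomputable def attractor (G : GameGraph V) (mine : V → Bool) (R U : Finset V) : Comp (Finset V) := do
  let cnt ← forEach (nodes V) (fun _ => 0) fun (cnt : V → ℕ) u =>
    forEach (G.succ u) cnt fun cnt v =>
      pure (if v ∈ R then Function.update cnt u (cnt u + 1) else cnt)
  let start ← forEach (nodes V) (⟨∅, cnt, []⟩ : AttrState V) fun s v =>
    pure (if v ∈ U then { s with set := insert v s.set, stack := v :: s.stack } else s)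
  let final ← whileLoop (fun s : AttrState V => !s.stack.isEmpty)
    (fun s => match s.stack with
      | [] => pure s
      | v :: rest => forEach (G.pred v) { s with stack := rest } fun s u =>
          pure (if u ∈ R ∧ u ∉ s.set then
              if mine u ∨ s.cnt u = 1 then
                { s with set := insert u s.set, stack := u :: s.stack }
              else { s with cnt := Function.update s.cnt u (s.cnt u - 1) }
            else s))
    start
  return final.set

/-- The winning region of Player 0 for the objective of staying in `I` forever, in the subgame on
`R`: the complement of the attractor of Player 1 to the nodes outside `I`. -/
noncomputable def safety (G : GameGraph V) (R I : Finset V) : Comp (Finset V) := do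
  let U ← nodesWhere fun v => v ∈ R ∧ v ∉ I
  let A ← attractor G (fun v => v ∉ G.V0) R U
  nodesWhere fun v => v ∈ R ∧ v ∉ A

/-- The nodes of `R` outside `A ⊆ R` from which Player 0 can force the play into `A` in one step of
the subgame on `R`. -/
def newPre (G : GameGraph V) (R A : Finset V) : Comp (Finset V) :=
  forEach (nodes V) ∅ fun B v => do
    let r ← forEach (G.succ v) (false, true) fun r u =>
      pure (r.1 || decide (u ∈ A), r.2 && decide (u ∉ R ∨ u ∈ A))
    return if v ∈ R ∧ v ∉ A ∧ (if v ∈ G.V0 then r.1 else r.2) then insert v B else B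

/-- The winning region of Player 0 in the co-Büchi game for `T`, in the subgame on `X`: as long as
Player 0 can stay in `T` forever from some node of what remains, remove her attractor to the set of
these nodes; she wins from the removed nodes. -/
noncomputable def coBuchiRegion (G : GameGraph V) (T X : Finset V) : Comp (Finset V) := do
  let A ← safety G X T
  let final ← whileLoop (fun s : Finset V × Finset V => decide (s.2 ≠ ∅))
    (fun s => do
      let B ← attractor G (fun v => v ∈ G.V0) s.1 s.2
      let R ← nodesWhere fun v => v ∈ s.1 ∧ v ∉ B
      let A ← safety G R T
      return (R, A))
    (X, A)
  nodesWhere fun v => v ∈ X ∧ v ∉ final.1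

/-- The output of the co-Büchi template algorithm: winning region, unsafe edges, co-live edges. -/
structure QualTemplate (V : Type) where
  region : Finset V
  S : Finset (V × V)
  D : Finset (V × V)

/-- The co-Büchi template algorithm for the objective `coBüchi(T) ∧ Safety(U)`. The nodes from which
Player 0 cannot stay in `U` are discarded first. The unsafe edges are the edges of Player 0 that
leave the winning region. Within the winning region, repeatedly: take the set `A` from which Player 0
can stay in `T` forever and mark her edges leaving `A` as co-live; grow `A` layer by layer to her
attractor and mark her edges that do not lead from a new layer into the earlier ones as co-live;
remove `A`. -/
noncomputable def coBuchiTemp (G : GameGraph V) (T U : Finset V) : Comp (QualTemplate V) := do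
  let X ← safety G Finset.univ U
  let Z ← coBuchiRegion G T X
  let S ← addEdges G ∅ fun u v => u ∈ G.V0 ∧ u ∈ Z ∧ v ∉ Z
  let final ← whileLoop (fun s : Finset V × Finset (V × V) => decide (s.1 ≠ ∅))
    (fun s => do
      let A ← safety G s.1 T
      let D ← addEdges G s.2 fun u v => u ∈ G.V0 ∧ u ∈ A ∧ v ∈ s.1 ∧ v ∉ A
      let B ← newPre G s.1 A
      -- the loop state consists of the grown set, the next layer and the co-live edges
      let grown ← whileLoop (fun r : Finset V × Finset V × Finset (V × V) => decide (r.2.1 ≠ ∅))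
        (fun r => do
          let D ← addEdges G r.2.2 fun u v => u ∈ G.V0 ∧ u ∈ r.2.1 ∧ v ∈ s.1 ∧ v ∉ r.1
          let A ← nodesWhere fun v => v ∈ r.1 ∨ v ∈ r.2.1
          let B ← newPre G s.1 A
          return (A, B, D))
        (A, B, D)
      let R ← nodesWhere fun v => v ∈ s.1 ∧ v ∉ grown.1
      return (R, grown.2.2))
    (Z, ∅)
  return ⟨Z, S, final.2⟩

/-! ### Quantitative part: edge-based value iteration -/

/-- `l ⊖ z = max (l - z) 0`, with `∞ ⊖ z = ∞`. -/
def ominus (l : ℕ∞) (z : ℤ) : ℕ∞ := ENat.map (fun k : ℕ => ((k : ℤ) - z).toNat) l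

/-- Values above the bound `b` are replaced by `∞`. -/
def cap (b : ℕ) (x : ℕ∞) : ℕ∞ := if x ≤ (b : ℕ∞) then x else ⊤

/-- State of the value iteration: the current edge function `μ`; for each node `u` the value `val u`,
which is the minimum (Player 0) or maximum (Player 1) of `μ` over `E(u)`; for each node of Player 0
the number `cnt u` of outgoing edges attaining `val u`; and the stack of the nodes whose value has
not been propagated to their incoming edges yet. -/
structure LiftState (V : Type) where
  μ : V × V → ℕ∞
  val : V → ℕ∞
  cnt : V → ℕ
  stack : List V

/-- The value of the node `u` under `μ` and, for a node of Player 0, the number of outgoing edges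
attaining it. -/
noncomputable def evalNode (G : GameGraph V) (μ : V × V → ℕ∞) (u : V) : Comp (ℕ∞ × ℕ) :=
  if u ∈ G.V0 then
    forEach (G.succ u) (⊤, 0) fun r v =>
      pure (if μ (u, v) < r.1 then (μ (u, v), 1)
        else if μ (u, v) = r.1 then (r.1, r.2 + 1) else r)
  else
    forEach (G.succ u) (0, 0) fun r v => pure (max r.1 (μ (u, v)), 0)

/-- Raise the value of the edge `(u, v)` to `x` and update the value of its source `u`. -/
noncomputable def lift (G : GameGraph V) (s : LiftState V) (u v : V) (x : ℕ∞) : Comp (LiftState V) :=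
  let μ := Function.update s.μ (u, v) x
  if u ∈ G.V0 then
    if s.μ (u, v) = s.val u then
      if s.cnt u = 1 then do
        let r ← evalNode G μ u
        return ⟨μ, Function.update s.val u r.1, Function.update s.cnt u r.2, u :: s.stack⟩
      else pure { s with μ := μ, cnt := Function.update s.cnt u (s.cnt u - 1) }
    else pure { s with μ := μ }
  else
    if s.val u < x then
      pure { s with μ := μ, val := Function.update s.val u x, stack := u :: s.stack }
    else pure { s with μ := μ }

/-- The fixed-point computation for the edge operator
`O(μ)(u, v) = min / max {μ e' ⊖ w (u, v) | e' ∈ E(v)}` (minimum if `v` belongs to Player 0, maximum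
otherwise), started in `μ₀`: values are only ever raised, an edge being raised to (the capped)
`O(μ)(u, v)` whenever its value is smaller, until none is. Values are capped at `|V| · W`. -/
noncomputable def fixPoint (G : GameGraph V) (w : V × V → ℤ) (W : ℕ) (μ₀ : V × V → ℕ∞) :
    Comp (V × V → ℕ∞) := do
  let start ← forEach (nodes V) (⟨μ₀, fun _ => 0, fun _ => 0, []⟩ : LiftState V) fun s u => do
    let r ← evalNode G s.μ u
    return { s with
      val := Function.update s.val u r.1
      cnt := Function.update s.cnt u r.2
      stack := u :: s.stack }
  let final ← whileLoop (fun s : LiftState V => !s.stack.isEmpty)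
    (fun s => match s.stack with
      | [] => pure s
      | v :: rest => forEach (G.pred v) { s with stack := rest } fun s u =>
          let x := cap (Fintype.card V * W) (ominus (s.val v) (w (u, v)))
          if s.μ (u, v) < x then lift G s u v x else pure s)
    start
  return final.μ

/-- Value iteration started in `μ₀`; returns the winning region read off from the resulting edge
function, and that edge function, which represents the template `QaSTel.ofValue`. -/
noncomputable def computeQaSTel (G : GameGraph V) (w : V × V → ℤ) (W : ℕ) (μ₀ : V × V → ℕ∞) :
    Comp (Finset V × (V × V → ℕ∞)) := do
  let μ ← fixPoint G w W μ₀
  let R ← forEach (nodes V) ∅ fun A v => do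
    let r ← forEach (G.succ v) (false, true) fun r u =>
      pure (r.1 || decide (μ (v, u) ≠ ⊤), r.2 && decide (μ (v, u) ≠ ⊤))
    return if (if v ∈ G.V0 then r.1 else r.2) then insert v A else A
  return (R, μ)

/-! ### The combined algorithm -/

/-- The conflicts in `R`: all edges of least value at nodes `v ∈ R` all of whose edges of least value
are unsafe or co-live. -/
noncomputable def conflicts (G : GameGraph V) (R : Finset V) (S D : Finset (V × V)) (μ : V × V → ℕ∞) :
    Comp (List (V × V)) :=
  forEach (nodes V) [] fun C v =>
    if v ∈ R then do
      let x ← forEach (G.succ v) (⊤ : ℕ∞) fun x u => pure (min x (μ (v, u)))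
      let bad ← forEach (G.succ v) true fun b u =>
        pure (b && decide (μ (v, u) = x → (v, u) ∈ S ∨ (v, u) ∈ D))
      if bad then
        forEach (G.succ v) C fun C u => pure (if μ (v, u) = x then (v, u) :: C else C)
      else pure C
    else pure C

/-- State of the main loop: the set `safe` such that the current qualitative objective is
`coBüchi(T) ∧ Safety(safe)`, the qualitative template for this objective, the edge function of the
quantitative template, the joint winning region, and the conflicts. -/
structure MainState (V : Type) where
  safe : Finset V
  qual : QualTemplate V
  μ : V × V → ℕ∞
  region : Finset V
  conf : List (V × V)

/-- Recompute the quantitative template, starting from `μ₀`, and find the conflicts with the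
qualitative template `Q` for the current qualitative objective. -/
noncomputable def findConf (G : GameGraph V) (w : V × V → ℤ) (W : ℕ) (safe : Finset V) (Q : QualTemplate V)
    (μ₀ : V × V → ℕ∞) : Comp (MainState V) := do
  let r ← computeQaSTel G w W μ₀
  let R ← nodesWhere fun v => v ∈ Q.region ∧ v ∈ r.1
  let C ← conflicts G R Q.S Q.D r.2
  return ⟨safe, Q, r.2, R, C⟩

/-- The algorithm computeMiSTel for the mean-payoff co-Büchi game with weights in `[-W; W]`. As long
as there are conflicts, conjoin the qualitative objective with staying in the joint winning region,
set the value of all conflicting edges to `∞`, and recompute both templates, the quantitative one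
starting from the current values; the qualitative template is recomputed only if the qualitative
objective has changed. -/
noncomputable def computeMiSTel (G : GameGraph V) (w : V × V → ℤ) (W : ℕ) (T : Finset V) :
    Comp (Finset V × MiSTel G) := do
  let μ₀ ← forEach (nodes V) (fun _ => 0) fun (μ : V × V → ℕ∞) u =>
    forEach (G.succ u) μ fun μ v => pure (Function.update μ (u, v) 0)
  let Q ← coBuchiTemp G T Finset.univ
  let start ← findConf G w W Finset.univ Q μ₀
  let final ← whileLoop (fun s : MainState V => !s.conf.isEmpty)
    (fun s => do
      let μ ← forEach s.conf s.μ fun μ e => pure (Function.update μ e ⊤)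
      let dropped ← nodesWhere fun v => v ∈ s.safe ∧ v ∉ s.region
      if dropped = ∅ then
        findConf G w W s.safe s.qual μ
      else do
        let safe ← nodesWhere fun v => v ∈ s.safe ∧ v ∈ s.region
        let Q ← coBuchiTemp G T safe
        findConf G w W safe Q μ)
    start
  return (final.region, ⟨final.qual.S, final.qual.D, QaSTel.ofValue G final.μ⟩)

end Algorithms

end MixedGame

open MixedGame

namespace MixedGame

/-! ## Reasoning about computations -/

/-- The computation `x` terminates, and its result and step count satisfy `Q`. -/
def Comp.Spec {α : Type} (x : Comp α) (Q : α → ℕ → Prop) : Prop :=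
  ∃ a t, x.run = some (a, t) ∧ Q a t

theorem Comp.Spec.mono {α : Type} {x : Comp α} {Q Q' : α → ℕ → Prop} (h : x.Spec Q)
    (hQ : ∀ a t, Q a t → Q' a t) : x.Spec Q' := by
  obtain ⟨a, t, h1, h2⟩ := h
  exact ⟨a, t, h1, hQ a t h2⟩

theorem Comp.Spec.pure {α : Type} {a : α} {Q : α → ℕ → Prop} (h : Q a 0) :
    (pure a : Comp α).Spec Q := ⟨a, 0, rfl, h⟩

theorem Comp.Spec.bind {α β : Type} {x : Comp α} {f : α → Comp β} {P : α → ℕ → Prop}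
    {Q : β → ℕ → Prop} (h : x.Spec P)
    (hf : ∀ a t, P a t → (f a).Spec fun b t' => Q b (t + t')) : (x >>= f).Spec Q := by
  obtain ⟨a, t, h1, h2⟩ := h
  obtain ⟨b, t', h3, h4⟩ := hf a t h2
  exact ⟨b, t + t', by simp [Comp.run_bind, h1, h3], h4⟩

theorem Comp.Spec.tick_bind {β : Type} {f : Unit → Comp β} {Q : β → ℕ → Prop}
    (h : (f ()).Spec fun b t => Q b (1 + t)) : (tick >>= f).Spec Q := by
  obtain ⟨b, t', h3, h4⟩ := h
  exact ⟨b, 1 + t', by simp [Comp.run_tick_bind, h3], h4⟩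

theorem Comp.Spec.of_run {α : Type} {x : Comp α} {a : α} {t : ℕ} (h : x.run = some (a, t)) :
    x.Spec fun b t' => b = a ∧ t' = t := ⟨a, t, h, rfl, rfl⟩

theorem forEach_cons {ι σ : Type} (i : ι) (l : List ι) (s : σ) (body : σ → ι → Comp σ) :
    forEach (i :: l) s body = tick >>= fun _ => body s i >>= fun s' => forEach l s' body := rfl

/-- A loop over a list all of whose rounds are known in advance is a fold. -/
theorem forEach_run {ι σ : Type} {body : σ → ι → Comp σ} (f : σ → ι → σ) (c : ι → ℕ)
    (h : ∀ s i, (body s i).run = some (f s i, c i)) (l : List ι) (s : σ) :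
    (forEach l s body).run = some (l.foldl f s, (l.map c).sum + l.length + 1) := by
  induction l generalizing s with
  | nil => rfl
  | cons i l ih =>
    rw [forEach_cons, Comp.run_tick_bind, Comp.run_bind, h]
    simp only [Option.bind_some, ih, Option.map_some, List.foldl_cons, List.map_cons,
      List.sum_cons, List.length_cons]
    congr 2
    ring

theorem forEach_pure_run {ι σ : Type} (f : σ → ι → σ) (l : List ι) (s : σ) :
    (forEach l s fun s i => pure (f s i)).run = some (l.foldl f s, l.length + 1) := by
  have := forEach_run (body := fun s i => pure (f s i)) f (fun _ => 0) (fun _ _ => rfl) l s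
  simpa using this

/-- The rule for loops over lists: `I l s` holds when the elements of `l` are still to be processed
in the state `s`, and `Φ` is a potential that pays for what exceeds `k`. -/
theorem forEach_spec {ι σ : Type} {body : σ → ι → Comp σ} (I : List ι → σ → Prop) (Φ : σ → ℕ)
    (k : ι → ℕ)
    (h : ∀ i l s, I (i :: l) s → (body s i).Spec fun s' t => I l s' ∧ t + Φ s' ≤ Φ s + k i)
    (l : List ι) (s : σ) (hs : I l s) :
    (forEach l s body).Spec fun s' t =>
      I [] s' ∧ t + Φ s' ≤ Φ s + (l.map k).sum + l.length + 1 := by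
  induction l generalizing s with
  | nil => exact ⟨s, 1, rfl, hs, by simp; omega⟩
  | cons i l ih =>
    rw [forEach_cons]
    refine Comp.Spec.tick_bind (Comp.Spec.bind (h i l s hs) fun a t ha => ?_)
    refine (ih a ha.1).mono fun b t' hb => ⟨hb.1, ?_⟩
    simp only [List.map_cons, List.sum_cons, List.length_cons]
    have := ha.2
    have := hb.2
    omega

/-- The rule for unbounded loops: `I` is an invariant and `Φ` a potential that pays for all
rounds. -/
theorem whileLoop_spec {σ : Type} {c : σ → Bool} {body : σ → Comp σ} (I : σ → Prop) (Φ : σ → ℕ)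
    (h : ∀ s, I s → c s = true → (body s).Spec fun s' t => I s' ∧ t + 1 + Φ s' ≤ Φ s)
    (s : σ) (hs : I s) :
    (whileLoop c body s).Spec fun s' t => I s' ∧ c s' = false ∧ t + Φ s' ≤ Φ s + 1 := by
  induction hn : Φ s using Nat.strong_induction_on generalizing s with
  | _ n ih =>
    rw [whileLoop_unfold]
    by_cases hc : c s = true
    · rw [if_pos hc]
      refine Comp.Spec.tick_bind (Comp.Spec.bind (h s hs hc) fun a t ha => ?_)
      refine (ih (Φ a) (by omega) a ha.1 rfl).mono fun b t' hb => ⟨hb.1, hb.2.1, ?_⟩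
      have := ha.2
      have := hb.2.2
      omega
    · rw [if_neg hc]
      exact ⟨s, 1, rfl, hs, by simpa using hc, by omega⟩

section Algorithms

variable {V : Type} [Fintype V] [LinearOrder V]

theorem mem_nodes (v : V) : v ∈ nodes V := by simp [nodes]

theorem nodup_nodes : (nodes V).Nodup := Finset.sort_nodup ..

theorem length_nodes : (nodes V).length = Fintype.card V := by simp [nodes]

theorem sum_nodes (f : V → ℕ) : ((nodes V).map f).sum = ∑ v, f v := by
  rw [← List.sum_toFinset _ nodup_nodes]
  congr 1
  ext v
  simp [mem_nodes]

namespace GameGraph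

variable (G : GameGraph V)

@[simp]
theorem mem_succ {u v : V} : v ∈ G.succ u ↔ (u, v) ∈ G.edges := by simp [succ]

@[simp]
theorem mem_pred {u v : V} : u ∈ G.pred v ↔ (u, v) ∈ G.edges := by simp [pred]

theorem nodup_succ (u : V) : (G.succ u).Nodup := Finset.sort_nodup ..

theorem nodup_pred (u : V) : (G.pred u).Nodup := Finset.sort_nodup ..

theorem sum_length_succ : ∑ u, (G.succ u).length = G.edges.card := by
  simp only [succ, Finset.length_sort, Finset.card_filter]
  rw [← Finset.sum_product', Finset.univ_product_univ, ← Finset.card_filter]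
  simp

theorem sum_length_pred : ∑ v, (G.pred v).length = G.edges.card := by
  simp only [pred, Finset.length_sort, Finset.card_filter]
  rw [Finset.sum_comm, ← Finset.sum_product', Finset.univ_product_univ, ← Finset.card_filter]
  simp

theorem card_le_card_edges (hG : ∀ v : V, ∃ v' : V, (v, v') ∈ G.edges) :
    Fintype.card V ≤ G.edges.card := by
  rw [← G.sum_length_succ, Fintype.card, Finset.card_eq_sum_ones]
  refine Finset.sum_le_sum fun v _ => ?_
  obtain ⟨v', hv⟩ := hG v
  exact List.length_pos_of_mem (G.mem_succ.2 hv)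

theorem card_edges_le {V : Type} [Fintype V] (G : GameGraph V) :
    G.edges.card ≤ Fintype.card V ^ 2 := by
  refine (Finset.card_le_univ _).trans ?_
  rw [Fintype.card_prod, sq]

end GameGraph

theorem nodesWhere_run (p : V → Bool) :
    (nodesWhere p).run = some (Finset.univ.filter fun v => p v, Fintype.card V + 1) := by
  rw [nodesWhere, forEach_pure_run, length_nodes]
  congr 2
  have key : ∀ (l : List V) (A : Finset V),
      l.foldl (fun A v => if p v then insert v A else A) A = A ∪ l.toFinset.filter fun v => p v := by
    intro l
    induction l with
    | nil => simp
    | cons a l ih =>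
      intro A
      rw [List.foldl_cons, ih]
      ext x
      by_cases ha : p a <;> simp [ha, Finset.filter_insert]
  rw [key]
  ext v
  simp [mem_nodes]

theorem addEdges_run (G : GameGraph V) (F : Finset (V × V)) (p : V → V → Bool) :
    (addEdges G F p).run = some (F ∪ G.edges.filter fun e => p e.1 e.2,
      G.edges.card + 2 * Fintype.card V + 1) := by
  rw [addEdges, forEach_run _ _ fun F u => forEach_pure_run
    (fun (F : Finset (V × V)) v => if p u v then insert (u, v) F else F) (G.succ u) F]
  rw [length_nodes, sum_nodes, Finset.sum_add_distrib, G.sum_length_succ]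
  congr 2
  · have key : ∀ (u : V) (l : List V) (A : Finset (V × V)) (e : V × V),
        e ∈ l.foldl (fun A v => if p u v then insert (u, v) A else A) A ↔
          e ∈ A ∨ (e.1 = u ∧ e.2 ∈ l ∧ p u e.2) := by
      intro u l
      induction l with
      | nil => simp
      | cons a l ih =>
        rintro A ⟨x, y⟩
        rw [List.foldl_cons, ih]
        by_cases ha : p u a <;> simp [ha] <;> grind
    have key2 : ∀ (l : List V) (A : Finset (V × V)) (e : V × V),
        e ∈ l.foldl (fun A u => (G.succ u).foldl
          (fun A v => if p u v then insert (u, v) A else A) A) A ↔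
          e ∈ A ∨ (e.1 ∈ l ∧ e ∈ G.edges ∧ p e.1 e.2) := by
      intro l
      induction l with
      | nil => simp
      | cons a l ih =>
        rintro A ⟨x, y⟩
        rw [List.foldl_cons, ih, key]
        simp only [GameGraph.mem_succ, List.mem_cons]
        grind
    ext e
    rw [key2]
    simp [mem_nodes]
  · simp
    ring

/-! ## Attractors and safety regions -/

/-- The property `P` of nodes is preserved by one attraction step of the player who owns the nodes
`mine`, in the subgame on `R`. -/
def AttrClosed (G : GameGraph V) (mine : V → Bool) (R : Finset V) (P : V → Prop) : Prop :=
  ∀ u ∈ R, (mine u = true → (∃ v ∈ R, (u, v) ∈ G.edges ∧ P v) → P u) ∧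
    (mine u = false → (∃ v ∈ R, (u, v) ∈ G.edges) → (∀ v ∈ R, (u, v) ∈ G.edges → P v) → P u)

/-- `A` is the attractor of `U` in the subgame on `R`. -/
structure IsAttr (G : GameGraph V) (mine : V → Bool) (R U A : Finset V) : Prop where
  subset : A ⊆ R
  base : U ⊆ A
  closed : AttrClosed G mine R (· ∈ A)
  least : ∀ P : V → Prop, (∀ v ∈ U, P v) → AttrClosed G mine R P → ∀ v ∈ A, P v

/-- The potential of the attractor computation. -/
def attrPotential (G : GameGraph V) (s : AttrState V) : ℕ :=
  ∑ v ∈ s.setᶜ, ((G.pred v).length + 2) + (s.stack.map fun v => (G.pred v).length + 2).sum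

theorem attrPotential_push (G : GameGraph V) {s : AttrState V} {u : V} (hu : u ∉ s.set)
    (cnt : V → ℕ) : attrPotential G ⟨insert u s.set, cnt, u :: s.stack⟩ = attrPotential G s := by
  simp only [attrPotential, Finset.compl_insert, List.map_cons, List.sum_cons]
  rw [← Finset.add_sum_erase s.setᶜ _ (Finset.mem_compl.2 hu)]
  ring

open Classical in
/-- The successors of `u` in the subgame on `R` from which no attraction has been propagated to `u`,
where `X` records the pairs for which the propagation is under way. -/
noncomputable def AttrState.pending (G : GameGraph V) (R : Finset V) (s : AttrState V)
    (X : V → V → Prop) (u : V) : Finset V :=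
  R.filter fun v => (u, v) ∈ G.edges ∧ (v ∈ s.stack ∨ v ∉ s.set ∨ X u v)

/-- The invariant of the attractor computation. -/
structure AttrInv (G : GameGraph V) (mine : V → Bool) (R U : Finset V) (X : V → V → Prop)
    (s : AttrState V) : Prop where
  nodup : s.stack.Nodup
  stack : ∀ v ∈ s.stack, v ∈ s.set
  subset : s.set ⊆ R
  base : U ⊆ s.set
  cnt : ∀ u ∈ R, u ∉ s.set → s.cnt u = (s.pending G R X u).card
  own : ∀ u ∈ R, u ∉ s.set → mine u = true → ∀ v ∈ R, (u, v) ∈ G.edges →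
    v ∈ s.stack ∨ v ∉ s.set ∨ X u v
  other : ∀ u ∈ R, u ∉ s.set → mine u = false → (∃ v ∈ R, (u, v) ∈ G.edges) →
    (s.pending G R X u).Nonempty
  least : ∀ P : V → Prop, (∀ v ∈ U, P v) → AttrClosed G mine R P → ∀ v ∈ s.set, P v

theorem AttrInv.congr {V : Type} [LinearOrder V] {G : GameGraph V} {mine : V → Bool} {R U : Finset V} {X Y : V → V → Prop}
    {s : AttrState V} (h : AttrInv G mine R U X s)
    (hXY : ∀ u ∈ R, u ∉ s.set → ∀ v, X u v ↔ Y u v) : AttrInv G mine R U Y s := by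
  have key : ∀ u ∈ R, u ∉ s.set → s.pending G R Y u = s.pending G R X u := by
    intro u hu hus
    ext v
    simp only [AttrState.pending, Finset.mem_filter, hXY u hu hus v]
  refine ⟨h.nodup, h.stack, h.subset, h.base, ?_, ?_, ?_, h.least⟩
  · intro u hu hus
    rw [key u hu hus, h.cnt u hu hus]
  · intro u hu hus hm v hv hE
    rw [← hXY u hu hus v]
    exact h.own u hu hus hm v hv hE
  · intro u hu hus
    rw [key u hu hus]
    exact h.other u hu hus

/-- Attracting a node preserves the invariant. -/
theorem AttrInv.push {V : Type} [LinearOrder V] {G : GameGraph V} {mine : V → Bool} {R U : Finset V} {X : V → V → Prop}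
    {s : AttrState V} (h : AttrInv G mine R U X s) {u : V} (hu : u ∈ R) (hus : u ∉ s.set)
    (hP : ∀ P : V → Prop, AttrClosed G mine R P → (∀ v ∈ s.set, P v) → P u) :
    AttrInv G mine R U X { s with set := insert u s.set, stack := u :: s.stack } := by
  have key : ∀ x, AttrState.pending G R { s with set := insert u s.set, stack := u :: s.stack } X x =
      s.pending G R X x := by
    intro x
    ext v
    simp only [AttrState.pending, Finset.mem_filter, List.mem_cons, Finset.mem_insert]
    by_cases hv : v = u
    · subst hv; simp [hus]
    · simp [hv]
  refine ⟨?_, ?_, ?_, ?_, ?_, ?_, ?_, ?_⟩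
  · exact List.nodup_cons.2 ⟨fun h' => hus (h.stack u h'), h.nodup⟩
  · intro v hv
    rcases List.mem_cons.1 hv with rfl | hv
    · exact Finset.mem_insert_self ..
    · exact Finset.mem_insert_of_mem (h.stack v hv)
  · exact Finset.insert_subset hu h.subset
  · exact h.base.trans (Finset.subset_insert _ _)
  · intro x hx hxs
    rw [key]
    exact h.cnt x hx fun h' => hxs (Finset.mem_insert_of_mem h')
  · intro x hx hxs hm v hv hE
    have := h.own x hx (fun h' => hxs (Finset.mem_insert_of_mem h')) hm v hv hE
    simp only [List.mem_cons, Finset.mem_insert]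
    tauto
  · intro x hx hxs
    rw [key]
    exact h.other x hx fun h' => hxs (Finset.mem_insert_of_mem h')
  · intro P hU hc v hv
    rcases Finset.mem_insert.1 hv with rfl | hv
    · exact hP P hc (h.least P hU hc)
    · exact h.least P hU hc v hv

/-- The round of the attractor computation that propagates the attraction from `v`. -/
theorem attractor_round (G : GameGraph V) (mine : V → Bool) (R U : Finset V) (v : V)
    (s : AttrState V) (hv : v ∈ s.set) (hvs : v ∉ s.stack)
    (hs : AttrInv G mine R U (fun _ x => x = v) s) :
    (forEach (G.pred v) s fun s u =>
      pure (if u ∈ R ∧ u ∉ s.set then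
          if mine u ∨ s.cnt u = 1 then
            { s with set := insert u s.set, stack := u :: s.stack }
          else { s with cnt := Function.update s.cnt u (s.cnt u - 1) }
        else s)).Spec fun s' t => AttrInv G mine R U (fun _ _ => False) s' ∧
          t + attrPotential G s' ≤ attrPotential G s + (G.pred v).length + 1 := by
  have hs0 : AttrInv G mine R U (fun u x => x = v ∧ u ∈ G.pred v) s := by
    refine ⟨hs.nodup, hs.stack, hs.subset, hs.base, ?_, ?_, ?_, hs.least⟩
    · intro u hu hus
      rw [hs.cnt u hu hus]
      congr 1
      ext x
      simp only [AttrState.pending, Finset.mem_filter, GameGraph.mem_pred]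
      grind
    · intro u hu hus hm x hx hE
      have := hs.own u hu hus hm x hx hE
      simp only [GameGraph.mem_pred]
      grind
    · intro u hu hus hm hx
      obtain ⟨x, hx⟩ := hs.other u hu hus hm hx
      refine ⟨x, ?_⟩
      simp only [AttrState.pending, Finset.mem_filter, GameGraph.mem_pred] at hx ⊢
      grind
  have main := forEach_spec (body := fun (s : AttrState V) u =>
      pure (if u ∈ R ∧ u ∉ s.set then
          if mine u ∨ s.cnt u = 1 then
            { s with set := insert u s.set, stack := u :: s.stack }
          else { s with cnt := Function.update s.cnt u (s.cnt u - 1) }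
        else s))
    (fun l s => l.Nodup ∧ (∀ u ∈ l, (u, v) ∈ G.edges) ∧ v ∈ s.set ∧ v ∉ s.stack ∧
      AttrInv G mine R U (fun u x => x = v ∧ u ∈ l) s) (attrPotential G) (fun _ => 0) ?_
    (G.pred v) s ⟨G.nodup_pred v, fun u hu => G.mem_pred.1 hu, hv, hvs, hs0⟩
  · refine main.mono fun s' t h => ⟨h.1.2.2.2.2.congr fun u _ _ x => by simp, ?_⟩
    simpa using h.2
  clear hs hs0 hv hvs s
  rintro u l s ⟨hl, hlE, hv, hvs, hs⟩
  obtain ⟨hul, hl⟩ := List.nodup_cons.1 hl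
  have huE : (u, v) ∈ G.edges := hlE u List.mem_cons_self
  have hlE' : ∀ u ∈ l, (u, v) ∈ G.edges := fun x hx => hlE x (List.mem_cons_of_mem _ hx)
  have hvR : v ∈ R := hs.subset hv
  apply Comp.Spec.pure
  by_cases hu : u ∈ R ∧ u ∉ s.set
  · have hvp : v ∈ s.pending G R (fun u' x => x = v ∧ u' ∈ u :: l) u := by
      simp [AttrState.pending, hvR, huE]
    rw [if_pos hu]
    by_cases hm : mine u = true ∨ s.cnt u = 1
    · rw [if_pos hm]
      have hpush := hs.push hu.1 hu.2 (fun P hc hP => by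
        by_cases hmu : mine u = true
        · exact (hc u hu.1).1 hmu ⟨v, hvR, huE, hP v hv⟩
        · have hc1 := hm.resolve_left hmu
          rw [hs.cnt u hu.1 hu.2, Finset.card_eq_one] at hc1
          obtain ⟨y, hy⟩ := hc1
          obtain rfl : v = y := by
            rw [hy] at hvp
            exact Finset.mem_singleton.1 hvp
          refine (hc u hu.1).2 (by simpa using hmu) ⟨v, hvR, huE⟩ fun x hx hxE => ?_
          by_contra hPx
          have hxs : x ∉ s.set := fun h' => hPx (hP x h')
          have : x ∈ s.pending G R (fun u' x => x = v ∧ u' ∈ u :: l) u := by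
            simp [AttrState.pending, hx, hxE, hxs]
          rw [hy, Finset.mem_singleton] at this
          exact hPx (this ▸ hP v hv))
      refine ⟨⟨hl, hlE', Finset.mem_insert_of_mem hv, ?_, hpush.congr ?_⟩, ?_⟩
      · intro h'
        rcases List.mem_cons.1 h' with rfl | h'
        · exact hu.2 hv
        · exact hvs h'
      · intro x _ hx y
        have : x ≠ u := fun h' => hx (by simp [h'])
        simp [this]
      · rw [attrPotential_push G hu.2]
        omega
    · rw [if_neg hm]
      push Not at hm
      have hother : ∀ x, x ≠ u → AttrState.pending G R
          { s with cnt := Function.update s.cnt u (s.cnt u - 1) } (fun u' x => x = v ∧ u' ∈ l) x =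
          s.pending G R (fun u' x => x = v ∧ u' ∈ u :: l) x := by
        intro x hx
        ext y
        simp [AttrState.pending, hx]
      have hself : AttrState.pending G R
          { s with cnt := Function.update s.cnt u (s.cnt u - 1) } (fun u' x => x = v ∧ u' ∈ l) u =
          (s.pending G R (fun u' x => x = v ∧ u' ∈ u :: l) u).erase v := by
        ext y
        simp only [AttrState.pending, Finset.mem_filter, Finset.mem_erase, List.mem_cons]
        grind
      have hcard := Finset.card_erase_of_mem hvp
      have hcu := hs.cnt u hu.1 hu.2
      have hpos := Finset.card_pos.2 ⟨v, hvp⟩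
      refine ⟨⟨hl, hlE', hv, hvs, hs.nodup, hs.stack, hs.subset, hs.base, ?_, ?_, ?_, hs.least⟩, ?_⟩
      · intro x hx hxs
        by_cases hxu : x = u
        · subst hxu
          rw [hself, hcard]
          simp [hcu]
        · rw [hother x hxu]
          simpa [hxu] using hs.cnt x hx hxs
      · intro x hx hxs hmx y hy hE
        have hxu : x ≠ u := fun h' => hm.1 (h' ▸ hmx)
        have := hs.own x hx hxs hmx y hy hE
        simpa [hxu] using this
      · intro x hx hxs hmx hex
        by_cases hxu : x = u
        · subst hxu
          rw [hself, ← Finset.card_pos, hcard]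
          have := hm.2
          omega
        · rw [hother x hxu]
          exact hs.other x hx hxs hmx hex
      · simp [attrPotential]
  · rw [if_neg hu]
    refine ⟨⟨hl, hlE', hv, hvs, hs.congr ?_⟩, by simp⟩
    intro x hx hxs y
    have : x ≠ u := fun h' => hu (h' ▸ ⟨hx, hxs⟩)
    simp [this]

theorem foldl_count {V : Type} [LinearOrder V] (R : Finset V) (l : V → List V) (us : List V) (hus : us.Nodup) (cnt : V → ℕ)
    (x : V) :
    us.foldl (fun cnt u => (l u).foldl (fun (cnt : V → ℕ) v =>
      if v ∈ R then Function.update cnt u (cnt u + 1) else cnt) cnt) cnt x =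
      cnt x + if x ∈ us then ((l x).filter fun v => v ∈ R).length else 0 := by
  have inner : ∀ (u : V) (l : List V) (cnt : V → ℕ), l.foldl (fun (cnt : V → ℕ) v =>
      if v ∈ R then Function.update cnt u (cnt u + 1) else cnt) cnt x =
      cnt x + if x = u then (l.filter fun v => v ∈ R).length else 0 := by
    intro u l
    induction l with
    | nil => simp
    | cons a l ih =>
      intro cnt
      rw [List.foldl_cons, ih]
      by_cases ha : a ∈ R <;> by_cases hx : x = u
      · subst hx; simp [ha]; ring
      all_goals simp [ha, hx]
  induction us generalizing cnt with
  | nil => simp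
  | cons u us ih =>
    obtain ⟨h1, h2⟩ := List.nodup_cons.1 hus
    rw [List.foldl_cons, ih h2, inner]
    by_cases hx : x = u
    · subst hx; simp [h1]
    · simp [hx]

theorem attractor_spec (G : GameGraph V) (mine : V → Bool) {R U : Finset V} (hU : U ⊆ R) :
    (attractor G mine R U).Spec fun A t => IsAttr G mine R U A ∧
      t ≤ 2 * G.edges.card + 5 * Fintype.card V + 3 := by
  rw [attractor]
  refine Comp.Spec.bind (Comp.Spec.of_run (forEach_run _ _ (fun cnt u => forEach_pure_run
    (fun (cnt : V → ℕ) v => if v ∈ R then Function.update cnt u (cnt u + 1) else cnt)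
    (G.succ u) cnt) _ _)) ?_
  rintro cnt t1 ⟨hcnt, ht1⟩
  rw [length_nodes, sum_nodes, Finset.sum_add_distrib, G.sum_length_succ] at ht1
  simp only [Finset.sum_const, Finset.card_univ, smul_eq_mul, mul_one] at ht1
  have hcnt' : ∀ u, cnt u = (R.filter fun v => (u, v) ∈ G.edges).card := by
    intro u
    rw [hcnt, foldl_count R G.succ _ nodup_nodes]
    simp only [mem_nodes, if_true, zero_add]
    rw [← List.toFinset_card_of_nodup ((G.nodup_succ u).filter _)]
    congr 1
    ext v
    simp [and_comm]
  have hstart := forEach_spec (body := fun (s : AttrState V) v =>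
      pure (if v ∈ U then { s with set := insert v s.set, stack := v :: s.stack } else s))
    (fun l s => s.cnt = cnt ∧ l.Nodup ∧ (∀ v ∈ l, v ∉ s.set) ∧ s.stack.Nodup ∧
      (∀ v, v ∈ s.stack ↔ v ∈ s.set) ∧ ∀ v, v ∈ s.set ∨ (v ∈ l ∧ v ∈ U) ↔ v ∈ U)
    (attrPotential G) (fun _ => 0) ?_ (nodes V) ⟨∅, cnt, []⟩
    ⟨rfl, nodup_nodes, by simp, by simp, by simp, by simp [mem_nodes]⟩
  · refine Comp.Spec.bind hstart ?_
    rintro s t2 ⟨⟨hsc, -, -, hnd, hst, hset⟩, ht2⟩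
    have hset : ∀ v, v ∈ s.set ↔ v ∈ U := by simpa using hset
    have hpend : ∀ u, s.pending G R (fun _ _ => False) u = R.filter fun v => (u, v) ∈ G.edges := by
      intro u
      ext v
      simp only [AttrState.pending, Finset.mem_filter, hst]
      tauto
    have hinv : AttrInv G mine R U (fun _ _ => False) s := by
      refine ⟨hnd, fun v hv => (hst v).1 hv, fun v hv => hU ((hset v).1 hv),
        fun v hv => (hset v).2 hv, ?_, ?_, ?_, ?_⟩
      · intro u _ _
        rw [hpend, hsc, hcnt']
      · intro u _ _ _ v _ _
        rw [hst]
        tauto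
      · rintro u _ _ _ ⟨v, hv⟩
        rw [hpend]
        exact ⟨v, by simpa using hv⟩
      · intro P hP _ v hv
        exact hP v ((hset v).1 hv)
    have hloop := whileLoop_spec (c := fun s : AttrState V => !s.stack.isEmpty)
      (body := fun s => match s.stack with
      | [] => pure s
      | v :: rest => forEach (G.pred v) { s with stack := rest } fun s u =>
          pure (if u ∈ R ∧ u ∉ s.set then
              if mine u ∨ s.cnt u = 1 then
                { s with set := insert u s.set, stack := u :: s.stack }
              else { s with cnt := Function.update s.cnt u (s.cnt u - 1) }
            else s)) (AttrInv G mine R U (fun _ _ => False)) (attrPotential G) ?_ s hinv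
    · refine Comp.Spec.bind hloop ?_
      rintro s' t3 ⟨hs', hemp, ht3⟩
      have hemp : s'.stack = [] := by simpa using hemp
      refine Comp.Spec.pure ⟨⟨hs'.subset, hs'.base, ?_, hs'.least⟩, ?_⟩
      · refine fun u hu => ⟨?_, ?_⟩
        · rintro hm ⟨v, hv, hE, hvs⟩
          by_contra hus
          have := hs'.own u hu hus hm v hv hE
          simp [hemp, hvs] at this
        · intro hm hex hall
          by_contra hus
          obtain ⟨x, hx⟩ := hs'.other u hu hus hm hex
          simp only [AttrState.pending, Finset.mem_filter, hemp] at hx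
          have := hall x hx.1 hx.2.1
          simp [this] at hx
      · have h0 : attrPotential G ⟨∅, cnt, []⟩ = G.edges.card + 2 * Fintype.card V := by
          simp [attrPotential, Finset.sum_add_distrib, G.sum_length_pred, mul_comm]
        rw [h0, length_nodes] at ht2
        simp only [List.map_const', List.sum_replicate, smul_zero] at ht2
        omega
    · clear hpend hinv hset hst hnd hsc ht2 hstart
      intro s hs hne
      obtain ⟨set, cnt', stack⟩ := s
      cases stack with
      | nil => simp at hne
      | cons v rest =>
        have hnd := List.nodup_cons.1 hs.nodup
        have hv := hs.stack v List.mem_cons_self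
        have hpend : ∀ u, AttrState.pending G R ⟨set, cnt', rest⟩ (fun _ x => x = v) u =
            AttrState.pending G R ⟨set, cnt', v :: rest⟩ (fun _ _ => False) u := by
          intro u
          ext x
          simp only [AttrState.pending, Finset.mem_filter, List.mem_cons]
          tauto
        have := attractor_round G mine R U v ⟨set, cnt', rest⟩ hv hnd.1 ⟨hnd.2,
          fun x hx => hs.stack x (List.mem_cons_of_mem _ hx), hs.subset, hs.base,
          fun u hu hus => by rw [hpend]; exact hs.cnt u hu hus,
          fun u hu hus hm x hx hE => by
            have := hs.own u hu hus hm x hx hE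
            simp only [List.mem_cons] at this
            tauto,
          fun u hu hus => by rw [hpend]; exact hs.other u hu hus, hs.least⟩
        refine this.mono fun s' t h => ⟨h.1, ?_⟩
        have h2 := h.2
        simp only [attrPotential, List.map_cons, List.sum_cons] at h2 ⊢
        omega
  · rintro v l s ⟨h1, h2, h3, h4, h5, h6⟩
    obtain ⟨hvl, hl⟩ := List.nodup_cons.1 h2
    apply Comp.Spec.pure
    by_cases hv : v ∈ U
    · rw [if_pos hv]
      have hvs := h3 v List.mem_cons_self
      refine ⟨⟨h1, hl, ?_, ?_, ?_, ?_⟩, ?_⟩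
      · intro x hx h'
        rcases Finset.mem_insert.1 h' with rfl | h'
        · exact hvl hx
        · exact h3 x (List.mem_cons_of_mem _ hx) h'
      · exact List.nodup_cons.2 ⟨fun h' => hvs ((h5 v).1 h'), h4⟩
      · intro x
        simp [h5]
      · intro x
        rw [← h6 x]
        simp only [Finset.mem_insert, List.mem_cons]
        grind
      · rw [attrPotential_push G hvs]
        omega
    · rw [if_neg hv]
      refine ⟨⟨h1, hl, fun x hx => h3 x (List.mem_cons_of_mem _ hx), h4, h5, ?_⟩, by simp⟩
      intro x
      rw [← h6 x]
      simp only [List.mem_cons]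
      grind

/-- `A` is the set of nodes from which Player 0 can stay in `I` forever in the subgame on `R`
(nodes of hers without successors in the subgame count as won). -/
structure IsSafe (G : GameGraph V) (R I A : Finset V) : Prop where
  subset : A ⊆ R
  subset_safe : A ⊆ I
  exists_succ : ∀ u ∈ A, u ∈ G.V0 → (∃ v ∈ R, (u, v) ∈ G.edges) → ∃ v ∈ A, (u, v) ∈ G.edges
  all_succ : ∀ u ∈ A, u ∉ G.V0 → ∀ v ∈ R, (u, v) ∈ G.edges → v ∈ A
  greatest : ∀ B ⊆ R, B ⊆ I → (∀ u ∈ B, u ∈ G.V0 → ∃ v ∈ B, (u, v) ∈ G.edges) →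
    (∀ u ∈ B, u ∉ G.V0 → ∀ v ∈ R, (u, v) ∈ G.edges → v ∈ B) → B ⊆ A

theorem safety_spec (G : GameGraph V) (R I : Finset V) :
    (safety G R I).Spec fun A t => IsSafe G R I A ∧
      t ≤ 2 * G.edges.card + 7 * Fintype.card V + 5 := by
  rw [safety]
  refine Comp.Spec.bind (Comp.Spec.of_run (nodesWhere_run _)) ?_
  rintro U t1 ⟨hU, ht1⟩
  have hU : ∀ v, v ∈ U ↔ v ∈ R ∧ v ∉ I := by simp [hU]
  refine Comp.Spec.bind (attractor_spec G _ fun v hv => ((hU v).1 hv).1) ?_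
  rintro A t2 ⟨hA, ht2⟩
  refine (Comp.Spec.of_run (nodesWhere_run _)).mono ?_
  rintro B t3 ⟨hB, ht3⟩
  have hB : ∀ v, v ∈ B ↔ v ∈ R ∧ v ∉ A := by simp [hB]
  refine ⟨⟨?_, ?_, ?_, ?_, ?_⟩, by omega⟩
  · exact fun v hv => ((hB v).1 hv).1
  · intro v hv
    by_contra hvI
    exact ((hB v).1 hv).2 (hA.base ((hU v).2 ⟨((hB v).1 hv).1, hvI⟩))
  · intro u hu hu0 hex
    by_contra! hno
    refine ((hB u).1 hu).2 ((hA.closed u ((hB u).1 hu).1).2 (by simpa using hu0) hex ?_)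
    intro v hv hE
    by_contra hvA
    exact hno v ((hB v).2 ⟨hv, hvA⟩) hE
  · intro u hu hu0 v hv hE
    refine (hB v).2 ⟨hv, fun hvA => ((hB u).1 hu).2 ?_⟩
    exact (hA.closed u ((hB u).1 hu).1).1 (by simpa using hu0) ⟨v, hv, hE, hvA⟩
  · intro C hCR hCI hC0 hC1 v hv
    refine (hB v).2 ⟨hCR hv, fun hvA => ?_⟩
    refine hA.least (· ∉ C) (fun x hx hxC => ((hU x).1 hx).2 (hCI hxC)) ?_ v hvA hv
    refine fun u hu => ⟨?_, ?_⟩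
    · rintro hm ⟨x, hx, hE, hxC⟩ huC
      exact hxC (hC1 u huC (by simpa using hm) x hx hE)
    · intro hm _ hall huC
      obtain ⟨x, hx, hE⟩ := hC0 u huC (by simpa using hm)
      exact hall x (hCR hx) hE hx

open Classical in
theorem newPre_run (G : GameGraph V) (R A : Finset V) :
    (newPre G R A).run = some (R.filter fun v => v ∉ A ∧
      (v ∈ G.V0 → ∃ u ∈ A, (v, u) ∈ G.edges) ∧
      (v ∉ G.V0 → ∀ u ∈ R, (v, u) ∈ G.edges → u ∈ A),
      G.edges.card + 2 * Fintype.card V + 1) := by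
  have inner : ∀ (l : List V) (r : Bool × Bool),
      l.foldl (fun r u => (r.1 || decide (u ∈ A), r.2 && decide (u ∉ R ∨ u ∈ A))) r =
        (r.1 || decide (∃ u ∈ l, u ∈ A), r.2 && decide (∀ u ∈ l, u ∈ R → u ∈ A)) := by
    intro l
    induction l with
    | nil => simp
    | cons a l ih =>
      intro r
      rw [List.foldl_cons, ih]
      by_cases h1 : a ∈ A <;> by_cases h2 : a ∈ R <;> simp [h1, h2]
  have outer := forEach_run (body := fun (B : Finset V) v => (do
      let r ← forEach (G.succ v) (false, true) fun r u =>
        pure (r.1 || decide (u ∈ A), r.2 && decide (u ∉ R ∨ u ∈ A))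
      return if v ∈ R ∧ v ∉ A ∧ (if v ∈ G.V0 then r.1 else r.2) then insert v B else B))
    (fun B v => if v ∈ R ∧ v ∉ A ∧ (v ∈ G.V0 → ∃ u ∈ A, (v, u) ∈ G.edges) ∧
      (v ∉ G.V0 → ∀ u ∈ R, (v, u) ∈ G.edges → u ∈ A) then insert v B else B)
    (fun v => (G.succ v).length + 1) ?_ (nodes V) ∅
  · rw [newPre, outer]
    rw [length_nodes, sum_nodes, Finset.sum_add_distrib, G.sum_length_succ]
    congr 2
    · have := nodesWhere_run (V := V) fun v => v ∈ R ∧ v ∉ A ∧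
        (v ∈ G.V0 → ∃ u ∈ A, (v, u) ∈ G.edges) ∧
        (v ∉ G.V0 → ∀ u ∈ R, (v, u) ∈ G.edges → u ∈ A)
      rw [nodesWhere, forEach_pure_run] at this
      simp only [Option.some.injEq, Prod.mk.injEq, decide_eq_true_eq] at this
      rw [this.1]
      ext v
      simp
    · simp
      ring
  · intro B v
    rw [Comp.run_bind, forEach_pure_run, inner]
    simp only [Option.bind_some, Comp.run_pure, Option.map_some, add_zero, Option.some.injEq,
      Prod.mk.injEq, and_true]
    by_cases hv : v ∈ G.V0
    · simp [hv, and_comm]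
    · simp only [hv, GameGraph.mem_succ]
      congr 1
      simp
      grind

/-! ## The co-Büchi template -/

/-- What the co-Büchi template construction uses of the winning region `Z` in the subgame on `X`. -/
structure IsRegion (G : GameGraph V) (T X Z : Finset V) : Prop where
  subset : Z ⊆ X
  exists_succ : ∀ u ∈ Z, u ∈ G.V0 → ∃ v ∈ Z, (u, v) ∈ G.edges
  all_succ : ∀ u ∈ Z, u ∉ G.V0 → ∀ v ∈ X, (u, v) ∈ G.edges → v ∈ Z
  core : ∀ R ⊆ Z, R.Nonempty → (∀ u ∈ R, u ∈ G.V0 → ∀ v ∈ Z, (u, v) ∈ G.edges → v ∈ R) →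
    (∀ u ∈ R, u ∉ G.V0 → ∃ v ∈ R, (u, v) ∈ G.edges) →
    ∃ A ⊆ R, A.Nonempty ∧ A ⊆ T ∧ (∀ u ∈ A, u ∈ G.V0 → ∃ v ∈ A, (u, v) ∈ G.edges) ∧
      ∀ u ∈ A, u ∉ G.V0 → ∀ v ∈ R, (u, v) ∈ G.edges → v ∈ A

/-- The state of the computation of the co-Büchi region: `R` remains. -/
structure RegionInv (G : GameGraph V) (T X R A : Finset V) : Prop where
  subset : R ⊆ X
  safe : IsSafe G R T A
  exists_succ : ∀ u ∈ R, u ∈ G.V0 → ∃ v ∈ R, (u, v) ∈ G.edges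
  region : IsRegion G T X (X \ R)

theorem RegionInv.step {V : Type} [LinearOrder V] {G : GameGraph V} {T X R A B : Finset V} (h : RegionInv G T X R A)
    (hB : IsAttr G (fun v => v ∈ G.V0) R A B) :
    (∀ u ∈ R \ B, u ∈ G.V0 → ∃ v ∈ R \ B, (u, v) ∈ G.edges) ∧ IsRegion G T X (X \ (R \ B)) := by
  have hex : ∀ u ∈ R \ B, u ∈ G.V0 → ∃ v ∈ R \ B, (u, v) ∈ G.edges := by
    intro u hu hu0
    obtain ⟨huR, huB⟩ := Finset.mem_sdiff.1 hu
    obtain ⟨v, hv, hE⟩ := h.exists_succ u huR hu0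
    refine ⟨v, Finset.mem_sdiff.2 ⟨hv, fun hvB => huB ?_⟩, hE⟩
    exact (hB.closed u huR).1 (by simpa using hu0) ⟨v, hv, hE, hvB⟩
  have hAB : ∀ u ∈ B, u ∈ B ∧ (u ∈ G.V0 → ∃ v ∈ B, (u, v) ∈ G.edges) ∧
      (u ∉ G.V0 → ∀ v ∈ R, (u, v) ∈ G.edges → v ∈ B) := by
    refine hB.least _ ?_ ?_
    · intro v hv
      refine ⟨hB.base hv, fun hv0 => ?_, fun hv0 x hx hE => hB.base (h.safe.all_succ v hv hv0 x hx hE)⟩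
      obtain ⟨x, hx, hE⟩ := h.safe.exists_succ v hv hv0 (h.exists_succ v (h.safe.subset hv) hv0)
      exact ⟨x, hB.base hx, hE⟩
    · refine fun u hu => ⟨?_, ?_⟩
      · rintro hm ⟨v, hv, hE, hP⟩
        refine ⟨(hB.closed u hu).1 hm ⟨v, hv, hE, hP.1⟩, fun _ => ⟨v, hP.1, hE⟩, fun h' => ?_⟩
        exact absurd (by simpa using hm) h'
      · intro hm hne hall
        refine ⟨(hB.closed u hu).2 hm hne fun v hv hE => (hall v hv hE).1, fun h' => ?_,
          fun _ v hv hE => (hall v hv hE).1⟩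
        exact absurd h' (by simpa using hm)
  have hmem : ∀ v, v ∈ X \ (R \ B) ↔ v ∈ X \ R ∨ v ∈ B := by
    intro v
    have := @h.subset v
    have := @hB.subset v
    simp only [Finset.mem_sdiff]
    tauto
  refine ⟨hex, Finset.sdiff_subset, ?_, ?_, ?_⟩
  · intro u hu hu0
    rcases (hmem u).1 hu with hu | hu
    · obtain ⟨v, hv, hE⟩ := h.region.exists_succ u hu hu0
      exact ⟨v, (hmem v).2 (Or.inl hv), hE⟩
    · obtain ⟨v, hv, hE⟩ := (hAB u hu).2.1 hu0
      exact ⟨v, (hmem v).2 (Or.inr hv), hE⟩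
  · intro u hu hu0 v hv hE
    rcases (hmem u).1 hu with hu | hu
    · exact (hmem v).2 (Or.inl (h.region.all_succ u hu hu0 v hv hE))
    · by_cases hvR : v ∈ R
      · exact (hmem v).2 (Or.inr ((hAB u hu).2.2 hu0 v hvR hE))
      · exact (hmem v).2 (Or.inl (Finset.mem_sdiff.2 ⟨hv, hvR⟩))
  · intro R' hR' hne h0 h1
    by_cases hR1 : (R' \ R).Nonempty
    · have hsub : R' \ R ⊆ X \ R := fun v hv => by
        have := Finset.mem_sdiff.1 (hR' (Finset.mem_sdiff.1 hv).1)
        exact Finset.mem_sdiff.2 ⟨this.1, (Finset.mem_sdiff.1 hv).2⟩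
      obtain ⟨C, hC, hCne, hCT, hC0, hC1⟩ := h.region.core (R' \ R) hsub hR1
        (fun u hu hu0 v hv hE => Finset.mem_sdiff.2
          ⟨h0 u (Finset.mem_sdiff.1 hu).1 hu0 v ((hmem v).2 (Or.inl hv)) hE,
            (Finset.mem_sdiff.1 hv).2⟩)
        (fun u hu hu0 => by
          obtain ⟨v, hv, hE⟩ := h1 u (Finset.mem_sdiff.1 hu).1 hu0
          have hvX : v ∈ X := (Finset.mem_sdiff.1 (hR' hv)).1
          have := h.region.all_succ u (hsub hu) hu0 v hvX hE
          exact ⟨v, Finset.mem_sdiff.2 ⟨hv, (Finset.mem_sdiff.1 this).2⟩, hE⟩)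
      refine ⟨C, fun v hv => (Finset.mem_sdiff.1 (hC hv)).1, hCne, hCT, hC0, ?_⟩
      intro u hu hu0 v hv hE
      have hvX : v ∈ X := (Finset.mem_sdiff.1 (hR' hv)).1
      have := h.region.all_succ u (hsub (hC hu)) hu0 v hvX hE
      exact hC1 u hu hu0 v (Finset.mem_sdiff.2 ⟨hv, (Finset.mem_sdiff.1 this).2⟩) hE
    · have hRB : ∀ v ∈ R', v ∈ B := by
        intro v hv
        rcases (hmem v).1 (hR' hv) with h' | h'
        · exact absurd ⟨v, Finset.mem_sdiff.2 ⟨hv, (Finset.mem_sdiff.1 h').2⟩⟩ hR1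
        · exact h'
      have hmeet : ∀ v ∈ B, v ∈ B ∧ (v ∈ R' → (R' ∩ A).Nonempty) := by
        refine hB.least _ ?_ ?_
        · exact fun v hv => ⟨hB.base hv, fun hv' => ⟨v, Finset.mem_inter.2 ⟨hv', hv⟩⟩⟩
        · refine fun u hu => ⟨?_, ?_⟩
          · rintro hm ⟨v, hv, hE, hP⟩
            refine ⟨(hB.closed u hu).1 hm ⟨v, hv, hE, hP.1⟩, fun huR' => hP.2 ?_⟩
            exact h0 u huR' (by simpa using hm) v ((hmem v).2 (Or.inr hP.1)) hE
          · intro hm hne hall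
            refine ⟨(hB.closed u hu).2 hm hne fun v hv hE => (hall v hv hE).1, fun huR' => ?_⟩
            obtain ⟨v, hv, hE⟩ := h1 u huR' (by simpa using hm)
            exact (hall v (hB.subset (hRB v hv)) hE).2 hv
      obtain ⟨x, hx⟩ := hne
      refine ⟨R' ∩ A, Finset.inter_subset_left, (hmeet x (hRB x hx)).2 hx,
        fun v hv => h.safe.subset_safe (Finset.mem_inter.1 hv).2, ?_, ?_⟩
      · intro u hu hu0
        obtain ⟨huR', huA⟩ := Finset.mem_inter.1 hu
        obtain ⟨v, hv, hE⟩ := h.safe.exists_succ u huA hu0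
          (h.exists_succ u (h.safe.subset huA) hu0)
        exact ⟨v, Finset.mem_inter.2 ⟨h0 u huR' hu0 v ((hmem v).2 (Or.inr (hB.base hv))) hE, hv⟩, hE⟩
      · intro u hu hu0 v hv hE
        obtain ⟨huR', huA⟩ := Finset.mem_inter.1 hu
        exact Finset.mem_inter.2 ⟨hv, h.safe.all_succ u huA hu0 v (hB.subset (hRB v hv)) hE⟩

theorem coBuchiRegion_spec (G : GameGraph V) (T X : Finset V)
    (hX : ∀ u ∈ X, u ∈ G.V0 → ∃ v ∈ X, (u, v) ∈ G.edges) :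
    (coBuchiRegion G T X).Spec fun Z t => IsRegion G T X Z ∧
      t ≤ (4 * G.edges.card + 13 * Fintype.card V + 10) * (Fintype.card V + 1) := by
  rw [coBuchiRegion]
  refine Comp.Spec.bind (safety_spec G X T) ?_
  rintro A t1 ⟨hA, ht1⟩
  have hinv : RegionInv G T X X A := by
    refine ⟨subset_rfl, hA, hX, ?_⟩
    rw [Finset.sdiff_self]
    refine ⟨by simp, by simp, by simp, fun R hR hne => ?_⟩
    exact absurd (Finset.subset_empty.1 hR) hne.ne_empty
  have hloop := whileLoop_spec (c := fun s : Finset V × Finset V => decide (s.2 ≠ ∅))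
    (body := fun s => do
      let B ← attractor G (fun v => v ∈ G.V0) s.1 s.2
      let R ← nodesWhere fun v => v ∈ s.1 ∧ v ∉ B
      let A ← safety G R T
      return (R, A)) (fun s => RegionInv G T X s.1 s.2)
    (fun s => (4 * G.edges.card + 13 * Fintype.card V + 10) * s.1.card) ?_ (X, A) hinv
  · refine Comp.Spec.bind hloop ?_
    rintro ⟨R, A'⟩ t2 ⟨hR, -, ht2⟩
    refine (Comp.Spec.of_run (nodesWhere_run _)).mono ?_
    rintro Z t3 ⟨rfl, rfl⟩
    have : (Finset.univ.filter fun v => decide (v ∈ X ∧ v ∉ R)) = X \ R := by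
      ext v
      simp
    rw [this]
    refine ⟨hR.region, ?_⟩
    have h1 := Finset.card_le_univ X
    have h2 := Nat.mul_le_mul_left (4 * G.edges.card + 13 * Fintype.card V + 10) h1
    rw [mul_add]
    simp only at ht2
    omega
  · rintro ⟨R, A⟩ hinv hne
    simp only at hinv hne ⊢
    have hne : A.Nonempty := Finset.nonempty_iff_ne_empty.2 (by simpa using hne)
    refine Comp.Spec.bind (attractor_spec G _ hinv.safe.subset) ?_
    rintro B t1 ⟨hB, ht1⟩
    refine Comp.Spec.bind (Comp.Spec.of_run (nodesWhere_run _)) ?_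
    rintro R' t2 ⟨hR', ht2⟩
    have hR' : R' = R \ B := by
      rw [hR']
      ext v
      simp
    subst hR'
    refine Comp.Spec.bind (safety_spec G (R \ B) T) ?_
    rintro A' t3 ⟨hA', ht3⟩
    obtain ⟨h1, h2⟩ := hinv.step hB
    refine Comp.Spec.pure ⟨⟨Finset.sdiff_subset.trans hinv.subset, hA', h1, h2⟩, ?_⟩
    have hlt : (R \ B).card + 1 ≤ R.card := by
      refine Finset.card_lt_card (Finset.sdiff_ssubset hB.subset ?_)
      exact hne.mono hB.base
    have := Nat.mul_le_mul_left (4 * G.edges.card + 13 * Fintype.card V + 10) hlt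
    rw [mul_add] at this
    simp only
    omega

/-- What the co-Büchi template guarantees. -/
structure IsTemplate (G : GameGraph V) (T : Finset V) (Q : QualTemplate V) : Prop where
  all_succ : ∀ u ∈ Q.region, u ∉ G.V0 → ∀ v, (u, v) ∈ G.edges → v ∈ Q.region
  mem_S : ∀ u v, (u, v) ∈ Q.S ↔ (u, v) ∈ G.edges ∧ u ∈ G.V0 ∧ u ∈ Q.region ∧ v ∉ Q.region
  mem_D : ∀ u v, (u, v) ∈ Q.D → (u, v) ∈ G.edges ∧ u ∈ G.V0 ∧ u ∈ Q.region
  exists_succ : ∀ u ∈ Q.region, u ∈ G.V0 → ∃ v ∈ Q.region, (u, v) ∈ G.edges ∧ (u, v) ∉ Q.D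
  rank : ∃ rank : V → ℕ, ∀ u ∈ Q.region, ∀ v ∈ Q.region, (u, v) ∈ G.edges → (u, v) ∉ Q.D →
    rank v ≤ rank u ∧ (u ∉ T → rank v < rank u)

/-- The nodes of `A` have got their co-live edges. -/
structure Settled (G : GameGraph V) (T Z A : Finset V) (D : Finset (V × V)) : Prop where
  mem_D : ∀ u v, (u, v) ∈ D → (u, v) ∈ G.edges ∧ u ∈ G.V0 ∧ u ∈ A
  exists_succ : ∀ u ∈ A, u ∈ G.V0 → ∃ v ∈ A, (u, v) ∈ G.edges ∧ (u, v) ∉ D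
  rank : ∃ rank : V → ℕ, ∀ u ∈ A, ∀ v ∈ Z, (u, v) ∈ G.edges → (u, v) ∉ D →
    v ∈ A ∧ rank v ≤ rank u ∧ (u ∉ T → rank v < rank u)

theorem Settled.extend {G : GameGraph V} {T Z A B : Finset V} {D N : Finset (V × V)}
    (h : Settled G T Z A D) (hAB : Disjoint A B)
    (hN : ∀ u v, (u, v) ∈ N → (u, v) ∈ G.edges ∧ u ∈ G.V0 ∧ u ∈ B)
    (hB : ∀ u ∈ B, u ∈ G.V0 → ∃ v ∈ A ∪ B, (u, v) ∈ G.edges ∧ (u, v) ∉ N)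
    (hstep : ∀ u ∈ B, ∀ v ∈ Z, (u, v) ∈ G.edges → (u, v) ∉ N → v ∈ A ∨ (v ∈ B ∧ u ∈ T)) :
    Settled G T Z (A ∪ B) (D ∪ N) := by
  have hdis : ∀ u, u ∈ A → u ∉ B := fun u h1 h2 => Finset.disjoint_left.1 hAB h1 h2
  refine ⟨?_, ?_, ?_⟩
  · intro u v huv
    rcases Finset.mem_union.1 huv with h' | h'
    · have := h.mem_D u v h'
      exact ⟨this.1, this.2.1, Finset.mem_union_left _ this.2.2⟩
    · have := hN u v h'
      exact ⟨this.1, this.2.1, Finset.mem_union_right _ this.2.2⟩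
  · intro u hu hu0
    rcases Finset.mem_union.1 hu with hu | hu
    · obtain ⟨v, hv, hE, hD⟩ := h.exists_succ u hu hu0
      refine ⟨v, Finset.mem_union_left _ hv, hE, fun h' => ?_⟩
      rcases Finset.mem_union.1 h' with h' | h'
      · exact hD h'
      · exact hdis u hu (hN u v h').2.2
    · obtain ⟨v, hv, hE, hD⟩ := hB u hu hu0
      refine ⟨v, hv, hE, fun h' => ?_⟩
      rcases Finset.mem_union.1 h' with h' | h'
      · exact hdis u (h.mem_D u v h').2.2 hu
      · exact hD h'
  · obtain ⟨rank, hrank⟩ := h.rank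
    refine ⟨fun v => if v ∈ B then Finset.univ.sup rank + 1 else rank v, ?_⟩
    intro u hu v hv hE hD
    beta_reduce
    simp only [Finset.mem_union, not_or] at hD
    have hle : rank v ≤ Finset.univ.sup rank := Finset.le_sup (Finset.mem_univ v)
    rcases Finset.mem_union.1 hu with hu | hu
    · obtain ⟨h1, h2⟩ := hrank u hu v hv hE hD.1
      rw [if_neg (hdis u hu), if_neg (hdis v h1)]
      exact ⟨Finset.mem_union_left _ h1, h2⟩
    · rw [if_pos hu]
      rcases hstep u hu v hv hE hD.2 with h' | ⟨h', hT⟩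
      · rw [if_neg (hdis v h')]
        exact ⟨Finset.mem_union_left _ h', by omega, fun _ => by omega⟩
      · rw [if_pos h']
        exact ⟨Finset.mem_union_right _ h', le_rfl, fun h'' => absurd hT h''⟩

/-- The state of the co-Büchi template computation: `R` remains of the region `Z`. -/
structure TemplateInv (G : GameGraph V) (T Z R : Finset V) (D : Finset (V × V)) : Prop where
  subset : R ⊆ Z
  succ0 : ∀ u ∈ R, u ∈ G.V0 → ∀ v ∈ Z, (u, v) ∈ G.edges → v ∈ R
  succ1 : ∀ u ∈ R, u ∉ G.V0 → ∃ v ∈ R, (u, v) ∈ G.edges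
  settled : Settled G T Z (Z \ R) D

/-- The state of the computation of the layers above a core. -/
structure LayerInv (G : GameGraph V) (T Z R A₀ A B : Finset V) (D : Finset (V × V)) : Prop where
  core : A₀ ⊆ A
  subset : A ⊆ R
  settled : Settled G T Z (Z \ (R \ A)) D
  mem_layer : ∀ v, v ∈ B ↔ v ∈ R ∧ v ∉ A ∧ (v ∈ G.V0 → ∃ u ∈ A, (v, u) ∈ G.edges) ∧
    (v ∉ G.V0 → ∀ u ∈ R, (v, u) ∈ G.edges → u ∈ A)

theorem newPre_spec (G : GameGraph V) (R A : Finset V) :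
    (newPre G R A).Spec fun B t => (∀ v, v ∈ B ↔ v ∈ R ∧ v ∉ A ∧
      (v ∈ G.V0 → ∃ u ∈ A, (v, u) ∈ G.edges) ∧
      (v ∉ G.V0 → ∀ u ∈ R, (v, u) ∈ G.edges → u ∈ A)) ∧
      t = G.edges.card + 2 * Fintype.card V + 1 := by
  refine (Comp.Spec.of_run (newPre_run G R A)).mono ?_
  rintro B t ⟨rfl, rfl⟩
  exact ⟨fun v => by classical simp, rfl⟩

theorem layers_spec (G : GameGraph V) (T Z R A₀ A B : Finset V) (D : Finset (V × V)) (hRZ : R ⊆ Z)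
    (h : LayerInv G T Z R A₀ A B D) :
    (whileLoop (fun r : Finset V × Finset V × Finset (V × V) => decide (r.2.1 ≠ ∅))
        (fun r => do
          let D ← addEdges G r.2.2 fun u v => u ∈ G.V0 ∧ u ∈ r.2.1 ∧ v ∈ R ∧ v ∉ r.1
          let A ← nodesWhere fun v => v ∈ r.1 ∨ v ∈ r.2.1
          let B ← newPre G R A
          return (A, B, D))
        (A, B, D)).Spec fun r t => LayerInv G T Z R A₀ r.1 r.2.1 r.2.2 ∧ r.2.1 = ∅ ∧
      t + (2 * G.edges.card + 5 * Fintype.card V + 4) * (R \ r.1).card ≤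
        (2 * G.edges.card + 5 * Fintype.card V + 4) * (R \ A).card + 1 := by
  have hloop := whileLoop_spec
    (c := fun r : Finset V × Finset V × Finset (V × V) => decide (r.2.1 ≠ ∅))
    (body := fun r => do
      let D ← addEdges G r.2.2 fun u v => u ∈ G.V0 ∧ u ∈ r.2.1 ∧ v ∈ R ∧ v ∉ r.1
      let A ← nodesWhere fun v => v ∈ r.1 ∨ v ∈ r.2.1
      let B ← newPre G R A
      return (A, B, D)) (fun r => LayerInv G T Z R A₀ r.1 r.2.1 r.2.2)
    (fun r => (2 * G.edges.card + 5 * Fintype.card V + 4) * (R \ r.1).card) ?_ (A, B, D) h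
  · exact hloop.mono fun r t hr => ⟨hr.1, by simpa using hr.2.1, hr.2.2⟩
  · clear h A B D
    rintro ⟨A, B, D⟩ h hne
    simp only at h hne ⊢
    have hne : B.Nonempty := Finset.nonempty_iff_ne_empty.2 (by simpa using hne)
    refine Comp.Spec.bind (Comp.Spec.of_run (addEdges_run G D _)) ?_
    rintro D' t1 ⟨hD', ht1⟩
    refine Comp.Spec.bind (Comp.Spec.of_run (nodesWhere_run _)) ?_
    rintro A' t2 ⟨hA', ht2⟩
    have hA' : A' = A ∪ B := by
      rw [hA']
      ext v
      simp
    subst hA'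
    refine Comp.Spec.bind (newPre_spec G R (A ∪ B)) ?_
    rintro B' t3 ⟨hB', ht3⟩
    have hBR : B ⊆ R \ A := fun v hv =>
      Finset.mem_sdiff.2 ⟨((h.mem_layer v).1 hv).1, ((h.mem_layer v).1 hv).2.1⟩
    have hABR : A ∪ B ⊆ R := Finset.union_subset h.subset (hBR.trans Finset.sdiff_subset)
    refine Comp.Spec.pure ⟨⟨h.core.trans Finset.subset_union_left, hABR, ?_, hB'⟩, ?_⟩
    · have hset : Z \ (R \ (A ∪ B)) = Z \ (R \ A) ∪ B := by
        ext v
        have h1 := @hRZ v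
        have h2 := @hBR v
        simp only [Finset.mem_sdiff, Finset.mem_union] at h2 ⊢
        tauto
      rw [hset, hD']
      refine h.settled.extend ?_ ?_ ?_ ?_
      · rw [Finset.disjoint_left]
        intro v hv hvB
        exact (Finset.mem_sdiff.1 hv).2 (hBR hvB)
      · intro u v huv
        simp only [Finset.mem_filter, decide_eq_true_eq] at huv
        exact ⟨huv.1, huv.2.1, huv.2.2.1⟩
      · intro u hu hu0
        obtain ⟨v, hv, hE⟩ := ((h.mem_layer u).1 hu).2.2.1 hu0
        refine ⟨v, Finset.mem_union_left _ (Finset.mem_sdiff.2 ⟨hRZ (h.subset hv), ?_⟩), hE, ?_⟩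
        · simp [hv]
        · simp [hv]
      · intro u hu v hv hE hN
        left
        refine Finset.mem_sdiff.2 ⟨hv, fun hvR => ?_⟩
        obtain ⟨hvR, hvA⟩ := Finset.mem_sdiff.1 hvR
        by_cases hu0 : u ∈ G.V0
        · simp [hE, hu0, hu, hvR, hvA] at hN
        · exact hvA (((h.mem_layer u).1 hu).2.2.2 hu0 v hvR hE)
    · have hlt : (R \ (A ∪ B)).card + 1 ≤ (R \ A).card := by
        rw [show R \ (A ∪ B) = (R \ A) \ B by
          ext v
          simp only [Finset.mem_union, Finset.mem_sdiff]
          tauto]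
        exact Finset.card_lt_card (Finset.sdiff_ssubset hBR hne)
      have := Nat.mul_le_mul_left (2 * G.edges.card + 5 * Fintype.card V + 4) hlt
      rw [mul_add] at this
      simp only
      omega

theorem TemplateInv.core {G : GameGraph V} {T Z R A : Finset V} {D : Finset (V × V)}
    (h : TemplateInv G T Z R D) (hZ0 : ∀ u ∈ Z, u ∈ G.V0 → ∃ v ∈ Z, (u, v) ∈ G.edges)
    (hA : IsSafe G R T A) :
    Settled G T Z (Z \ (R \ A)) (D ∪ G.edges.filter fun e =>
      decide (e.1 ∈ G.V0 ∧ e.1 ∈ A ∧ e.2 ∈ R ∧ e.2 ∉ A) = true) := by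
  have hset : Z \ (R \ A) = Z \ R ∪ A := by
    ext v
    have h1 := @h.subset v
    have h2 := @hA.subset v
    simp only [Finset.mem_sdiff, Finset.mem_union]
    tauto
  rw [hset]
  refine h.settled.extend ?_ ?_ ?_ ?_
  · rw [Finset.disjoint_left]
    intro v hv hvA
    exact (Finset.mem_sdiff.1 hv).2 (hA.subset hvA)
  · intro u v huv
    simp only [Finset.mem_filter, decide_eq_true_eq] at huv
    exact ⟨huv.1, huv.2.1, huv.2.2.1⟩
  · intro u hu hu0
    obtain ⟨x, hx, hxE⟩ := hZ0 u (h.subset (hA.subset hu)) hu0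
    obtain ⟨v, hv, hE⟩ := hA.exists_succ u hu hu0
      ⟨x, h.succ0 u (hA.subset hu) hu0 x hx hxE, hxE⟩
    exact ⟨v, Finset.mem_union_right _ hv, hE, by simp [hv]⟩
  · intro u hu v hv hE hN
    by_cases hvA : v ∈ A
    · exact Or.inr ⟨hvA, hA.subset_safe hu⟩
    · left
      refine Finset.mem_sdiff.2 ⟨hv, fun hvR => ?_⟩
      by_cases hu0 : u ∈ G.V0
      · simp [hE, hu0, hu, hvR, hvA] at hN
      · exact hvA (hA.all_succ u hu hu0 v hvR hE)

theorem LayerInv.remove {V : Type} [LinearOrder V] {G : GameGraph V} {T Z R A₀ A : Finset V} {D D₀ : Finset (V × V)}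
    (h : LayerInv G T Z R A₀ A ∅ D) (hR : TemplateInv G T Z R D₀) :
    TemplateInv G T Z (R \ A) D := by
  refine ⟨Finset.sdiff_subset.trans hR.subset, ?_, ?_, h.settled⟩
  · intro u hu hu0 v hv hE
    obtain ⟨huR, huA⟩ := Finset.mem_sdiff.1 hu
    refine Finset.mem_sdiff.2 ⟨hR.succ0 u huR hu0 v hv hE, fun hvA => ?_⟩
    exact Finset.notMem_empty u ((h.mem_layer u).2 ⟨huR, huA, fun _ => ⟨v, hvA, hE⟩,
      fun h' => absurd hu0 h'⟩)
  · intro u hu hu0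
    obtain ⟨huR, huA⟩ := Finset.mem_sdiff.1 hu
    by_contra! hno
    refine Finset.notMem_empty u ((h.mem_layer u).2 ⟨huR, huA, fun h' => absurd h' hu0,
      fun _ v hv hE => ?_⟩)
    by_contra hvA
    exact hno v (Finset.mem_sdiff.2 ⟨hv, hvA⟩) hE

theorem coBuchiTemp_spec (G : GameGraph V) (hG : ∀ v : V, ∃ v' : V, (v, v') ∈ G.edges)
    (T U : Finset V) :
    (coBuchiTemp G T U).Spec fun Q t => IsTemplate G T Q ∧
      t ≤ (10 * G.edges.card + 30 * Fintype.card V + 24) * (Fintype.card V + 1) := by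
  rw [coBuchiTemp]
  refine Comp.Spec.bind (safety_spec G Finset.univ U) ?_
  rintro X t1 ⟨hX, ht1⟩
  have hX0 : ∀ u ∈ X, u ∈ G.V0 → ∃ v ∈ X, (u, v) ∈ G.edges := fun u hu hu0 =>
    hX.exists_succ u hu hu0 (by simpa using hG u)
  refine Comp.Spec.bind (coBuchiRegion_spec G T X hX0) ?_
  rintro Z t2 ⟨hZ, ht2⟩
  have hZ1 : ∀ u ∈ Z, u ∉ G.V0 → ∀ v, (u, v) ∈ G.edges → v ∈ Z := fun u hu hu0 v hE =>
    hZ.all_succ u hu hu0 v (hX.all_succ u (hZ.subset hu) hu0 v (Finset.mem_univ v) hE) hE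
  refine Comp.Spec.bind (Comp.Spec.of_run (addEdges_run G ∅ _)) ?_
  rintro S t3 ⟨hS, ht3⟩
  have hinv : TemplateInv G T Z Z ∅ := by
    refine ⟨subset_rfl, fun u hu hu0 v hv hE => hv, fun u hu hu0 => ?_, ?_⟩
    · obtain ⟨v, hE⟩ := hG u
      exact ⟨v, hZ1 u hu hu0 v hE, hE⟩
    · rw [Finset.sdiff_self]
      exact ⟨by simp, by simp, fun _ => 0, by simp⟩
  have hloop := whileLoop_spec
    (c := fun s : Finset V × Finset (V × V) => decide (s.1 ≠ ∅))
    (body := fun s => do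
      let A ← safety G s.1 T
      let D ← addEdges G s.2 fun u v => u ∈ G.V0 ∧ u ∈ A ∧ v ∈ s.1 ∧ v ∉ A
      let B ← newPre G s.1 A
      let grown ← whileLoop (fun r : Finset V × Finset V × Finset (V × V) => decide (r.2.1 ≠ ∅))
        (fun r => do
          let D ← addEdges G r.2.2 fun u v => u ∈ G.V0 ∧ u ∈ r.2.1 ∧ v ∈ s.1 ∧ v ∉ r.1
          let A ← nodesWhere fun v => v ∈ r.1 ∨ v ∈ r.2.1
          let B ← newPre G s.1 A
          return (A, B, D))
        (A, B, D)
      let R ← nodesWhere fun v => v ∈ s.1 ∧ v ∉ grown.1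
      return (R, grown.2.2)) (fun s => TemplateInv G T Z s.1 s.2)
    (fun s => (6 * G.edges.card + 17 * Fintype.card V + 14) * s.1.card) ?_ (Z, ∅) hinv
  · refine Comp.Spec.bind hloop ?_
    rintro ⟨R, D⟩ t4 ⟨hR, hemp, ht4⟩
    simp only [ne_eq, decide_not, Bool.not_eq_eq_eq_not, Bool.not_false, decide_eq_true_eq] at hemp
    subst hemp
    have hset := hR.settled
    simp only [Finset.sdiff_empty] at hset
    refine Comp.Spec.pure ⟨⟨hZ1, ?_, hset.mem_D, hset.exists_succ, ?_⟩, ?_⟩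
    · intro u v
      rw [hS]
      simp
    · obtain ⟨rank, hrank⟩ := hset.rank
      exact ⟨rank, fun u hu v hv hE hD => (hrank u hu v hv hE hD).2⟩
    · have h1 := Finset.card_le_univ Z
      have h2 := Nat.mul_le_mul_left (6 * G.edges.card + 17 * Fintype.card V + 14) h1
      simp only at ht4
      have h3 : (10 * G.edges.card + 30 * Fintype.card V + 24) * (Fintype.card V + 1) =
        (4 * G.edges.card + 13 * Fintype.card V + 10) * (Fintype.card V + 1) +
        (6 * G.edges.card + 17 * Fintype.card V + 14) * Fintype.card V +
        (6 * G.edges.card + 17 * Fintype.card V + 14) := by ring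
      rw [h3]
      omega
  · rintro ⟨R, D⟩ hinv hne
    simp only at hinv hne ⊢
    have hne : R.Nonempty := Finset.nonempty_iff_ne_empty.2 (by simpa using hne)
    refine Comp.Spec.bind (safety_spec G R T) ?_
    rintro A t1 ⟨hA, ht1⟩
    refine Comp.Spec.bind (Comp.Spec.of_run (addEdges_run G D _)) ?_
    rintro D' t2 ⟨rfl, ht2⟩
    refine Comp.Spec.bind (newPre_spec G R A) ?_
    rintro B t3 ⟨hB, ht3⟩
    have hlayer : LayerInv G T Z R A A B _ :=
      ⟨subset_rfl, hA.subset, hinv.core hZ.exists_succ hA, hB⟩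
    refine Comp.Spec.bind (layers_spec G T Z R A A B _ hinv.subset hlayer) ?_
    rintro ⟨A', B', D''⟩ t4 ⟨hlay, rfl, ht4⟩
    refine Comp.Spec.bind (Comp.Spec.of_run (nodesWhere_run _)) ?_
    rintro R' t5 ⟨hR', ht5⟩
    have hR' : R' = R \ A' := by
      rw [hR']
      ext v
      simp
    subst hR'
    refine Comp.Spec.pure ⟨hlay.remove hinv, ?_⟩
    have hAne : A.Nonempty := by
      obtain ⟨C, hC, ⟨x, hx⟩, hCT, hC0, hC1⟩ := hZ.core R hinv.subset hne hinv.succ0 hinv.succ1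
      exact ⟨x, hA.greatest C hC hCT hC0 hC1 hx⟩
    have hlt : (R \ A').card + 1 ≤ R.card :=
      Finset.card_lt_card (Finset.sdiff_ssubset hlay.subset (hAne.mono hlay.core))
    have hle : (R \ A).card ≤ R.card := Finset.card_le_card Finset.sdiff_subset
    have e1 := Nat.mul_le_mul_left (4 * G.edges.card + 12 * Fintype.card V + 10) hlt
    have e2 := Nat.mul_le_mul_left (2 * G.edges.card + 5 * Fintype.card V + 4) hle
    have e3 : ∀ x, (6 * G.edges.card + 17 * Fintype.card V + 14) * x =
      (4 * G.edges.card + 12 * Fintype.card V + 10) * x +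
      (2 * G.edges.card + 5 * Fintype.card V + 4) * x := fun x => by ring
    simp only [e3, mul_add] at e1 ht4 ⊢
    omega

/-! ## Value iteration -/

/-- The value of a node under an edge function. -/
noncomputable def nodeVal (G : GameGraph V) (μ : V × V → ℕ∞) (u : V) : ℕ∞ :=
  if u ∈ G.V0 then (G.succ u).toFinset.inf fun v => μ (u, v)
  else (G.succ u).toFinset.sup fun v => μ (u, v)

/-- The number of outgoing edges of a node of Player 0 that attain its value. -/
noncomputable def nodeCnt (G : GameGraph V) (μ : V × V → ℕ∞) (u : V) : ℕ :=
  if u ∈ G.V0 then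
    ((G.succ u).toFinset.filter fun v => μ (u, v) = (G.succ u).toFinset.inf fun v => μ (u, v)).card
  else 0

theorem nodeVal_mono (G : GameGraph V) {μ μ' : V × V → ℕ∞} (h : μ ≤ μ') (u : V) :
    nodeVal G μ u ≤ nodeVal G μ' u := by
  unfold nodeVal
  split_ifs
  · exact Finset.inf_mono_fun fun v _ => h _
  · exact Finset.sup_mono_fun fun v _ => h _

theorem foldl_min_count {ι : Type} [DecidableEq ι] (f : ι → ℕ∞) (l : List ι) (hl : l.Nodup) :
    l.foldl (fun (r : ℕ∞ × ℕ) v => if f v < r.1 then (f v, 1)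
      else if f v = r.1 then (r.1, r.2 + 1) else r) (⊤, 0) =
      (l.toFinset.inf f, (l.toFinset.filter fun v => f v = l.toFinset.inf f).card) := by
  induction l using List.reverseRecOn with
  | nil => simp
  | append_singleton l a ih =>
    have hl' : a ∉ l ∧ l.Nodup := by
      rw [List.nodup_append] at hl
      exact ⟨fun h => hl.2.2 a h a (by simp) rfl, hl.1⟩
    rw [List.foldl_append, ih hl'.2]
    have hset : (l ++ [a]).toFinset = insert a l.toFinset := by
      ext x
      simp
    have ha : a ∉ l.toFinset := by simpa using hl'.1
    have hge : ∀ x ∈ l.toFinset, l.toFinset.inf f ≤ f x := fun x hx => Finset.inf_le hx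
    rw [hset, Finset.inf_insert]
    simp only [List.foldl_cons, List.foldl_nil]
    generalize l.toFinset = S at *
    split_ifs with h1 h2
    · rw [inf_eq_left.2 h1.le, Finset.filter_insert, if_pos rfl,
        Finset.filter_false_of_mem fun x hx => (h1.trans_le (hge x hx)).ne']
      simp
    · rw [inf_eq_right.2 h2.ge, Finset.filter_insert, if_pos h2, Finset.card_insert_of_notMem]
      simp [ha]
    · rw [inf_eq_right.2 (not_lt.1 h1), Finset.filter_insert, if_neg h2]

theorem foldl_max {ι : Type} [DecidableEq ι] (f : ι → ℕ∞) (l : List ι) (r : ℕ∞) :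
    l.foldl (fun (r : ℕ∞ × ℕ) v => (max r.1 (f v), 0)) (r, 0) = (r ⊔ l.toFinset.sup f, 0) := by
  induction l generalizing r with
  | nil => simp
  | cons a l ih => rw [List.foldl_cons, ih, List.toFinset_cons, Finset.sup_insert, sup_assoc]

theorem evalNode_run (G : GameGraph V) (μ : V × V → ℕ∞) (u : V) :
    (evalNode G μ u).run = some ((nodeVal G μ u, nodeCnt G μ u), (G.succ u).length + 1) := by
  unfold evalNode nodeVal nodeCnt
  split_ifs
  · rw [forEach_pure_run]
    exact congrArg (fun x => some (x, (G.succ u).length + 1))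
      (foldl_min_count (fun v => μ (u, v)) (G.succ u) (G.nodup_succ u))
  · rw [forEach_pure_run]
    refine congrArg (fun x => some (x, (G.succ u).length + 1))
      ((foldl_max (fun v => μ (u, v)) (G.succ u) 0).trans ?_)
    simp

section Update

variable {ι : Type} [DecidableEq ι] {S : Finset ι} {f f' : ι → ℕ∞} {v : ι}

theorem inf_lt_inf_of_unique (hv : v ∈ S) (hinf : f v = S.inf f)
    (hcard : (S.filter fun y => f y = S.inf f).card = 1) (hlt : f v < f' v)
    (hf' : ∀ y, y ≠ v → f' y = f y) : S.inf f < S.inf f' := by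
  obtain ⟨z, hz⟩ := Finset.card_eq_one.1 hcard
  have hvz : v = z := by
    have : v ∈ S.filter fun y => f y = S.inf f := by simp [hv, hinf]
    rw [hz] at this
    exact Finset.mem_singleton.1 this
  rw [Finset.lt_inf_iff (by rw [← hinf]; exact hlt.trans_le le_top)]
  intro y hy
  by_cases hyv : y = v
  · rw [hyv, ← hinf]
    exact hlt
  · rw [hf' y hyv]
    refine lt_of_le_of_ne (Finset.inf_le hy) fun h => hyv ?_
    have : y ∈ S.filter fun y => f y = S.inf f := by simp [hy, ← h]
    rw [hz] at this
    rw [Finset.mem_singleton.1 this, hvz]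

theorem inf_eq_inf_of_not_unique (hv : v ∈ S)
    (hcard : ¬ (f v = S.inf f ∧ (S.filter fun y => f y = S.inf f).card = 1)) (hlt : f v < f' v)
    (hf' : ∀ y, y ≠ v → f' y = f y) : S.inf f' = S.inf f := by
  have hex : ∃ i ∈ S, i ≠ v ∧ f i = S.inf f := by
    by_cases h : f v = S.inf f
    · have hne : (S.filter fun y => f y = S.inf f).Nonempty := ⟨v, by simp [hv, h]⟩
      have h1 : 1 < (S.filter fun y => f y = S.inf f).card := by
        have := hne.card_pos
        have : ¬ (S.filter fun y => f y = S.inf f).card = 1 := fun h' => hcard ⟨h, h'⟩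
        omega
      obtain ⟨i, hi, hiv⟩ := Finset.exists_mem_ne h1 v
      rw [Finset.mem_filter] at hi
      exact ⟨i, hi.1, hiv, hi.2⟩
    · obtain ⟨i, hi, h'⟩ := Finset.exists_mem_eq_inf S ⟨v, hv⟩ f
      refine ⟨i, hi, fun hiv => h ?_, h'.symm⟩
      rw [h', hiv]
  obtain ⟨i, hi, hiv, hfi⟩ := hex
  refine le_antisymm ?_ (Finset.inf_mono_fun fun y _ => ?_)
  · rw [← hfi, ← hf' i hiv]
    exact Finset.inf_le hi
  · by_cases hyv : y = v
    · rw [hyv]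
      exact hlt.le
    · rw [hf' y hyv]

theorem filter_eq_inf_update (hv : v ∈ S) (hlt : f v < f' v) (hf' : ∀ y, y ≠ v → f' y = f y) :
    (S.filter fun y => f' y = S.inf f) = (S.filter fun y => f y = S.inf f).erase v := by
  ext y
  by_cases hyv : y = v
  · subst hyv
    have := (Finset.inf_le (f := f) hv).trans_lt hlt
    simp [this.ne']
  · simp [hyv, hf' y hyv]

end Update

/-- Node values and edge values are at most `b` or infinite. -/
def Bounded (b : ℕ) (x : ℕ∞) : Prop := x ≤ (b : ℕ∞) ∨ x = ⊤

theorem bounded_cap (b : ℕ) (x : ℕ∞) : Bounded b (cap b x) := by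
  unfold cap Bounded
  split_ifs with h
  · exact Or.inl h
  · exact Or.inr rfl

/-- How often a value bounded by `b` can still be raised. -/
noncomputable def room (b : ℕ) (x : ℕ∞) : ℕ := if x = ⊤ then 0 else b + 1 - x.toNat

theorem room_anti (b : ℕ) {x y : ℕ∞} (h : x ≤ y) : room b y ≤ room b x := by
  unfold room
  by_cases hy : y = ⊤
  · simp [hy]
  · have hx : x ≠ ⊤ := fun hx => hy (top_le_iff.1 (hx ▸ h))
    rw [if_neg hy, if_neg hx]
    have := ENat.toNat_le_toNat h hy
    omega

theorem room_lt (b : ℕ) {x y : ℕ∞} (h : x < y) (hx : Bounded b x) : room b y + 1 ≤ room b x := by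
  have hx' : x ≠ ⊤ := (h.trans_le le_top).ne
  have hxb : x ≤ b := hx.resolve_right hx'
  lift x to ℕ using hx'
  unfold room
  have hxb' : x ≤ b := by exact_mod_cast hxb
  by_cases hy : y = ⊤
  · simp [hy]
    omega
  · lift y to ℕ using hy
    have : x < y := by exact_mod_cast h
    simp
    omega

theorem room_le (b : ℕ) (x : ℕ∞) : room b x ≤ b + 1 := by
  unfold room
  split_ifs <;> omega

theorem bounded_nodeVal (G : GameGraph V) {b : ℕ} {μ : V × V → ℕ∞} (hμ : ∀ e, Bounded b (μ e))
    {u v : V} (hE : (u, v) ∈ G.edges) : Bounded b (nodeVal G μ u) := by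
  have hne : (G.succ u).toFinset.Nonempty := ⟨v, by simpa using hE⟩
  unfold nodeVal
  split_ifs
  · obtain ⟨i, -, h⟩ := Finset.exists_mem_eq_inf _ hne fun v => μ (u, v)
    rw [h]
    exact hμ _
  · obtain ⟨i, -, h⟩ := Finset.exists_mem_eq_sup _ hne fun v => μ (u, v)
    rw [h]
    exact hμ _

/-- The part of the potential of the value iteration that depends on the node values. -/
noncomputable def valuePotential (G : GameGraph V) (b : ℕ) (val : V → ℕ∞) : ℕ :=
  ∑ u, room b (val u) * ((G.succ u).length + (G.pred u).length + 3)

/-- The part of the potential of the value iteration that depends on the stack. -/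
def stackPotential (G : GameGraph V) (stack : List V) : ℕ :=
  (stack.map fun v => (G.pred v).length + 2).sum

theorem valuePotential_anti (G : GameGraph V) (b : ℕ) {val val' : V → ℕ∞} (h : val ≤ val') :
    valuePotential G b val' ≤ valuePotential G b val :=
  Finset.sum_le_sum fun u _ => Nat.mul_le_mul_right _ (room_anti b (h u))

theorem valuePotential_update (G : GameGraph V) (b : ℕ) {val : V → ℕ∞} {u : V} {y : ℕ∞}
    (hlt : val u < y) (hb : Bounded b (val u)) :
    valuePotential G b (Function.update val u y) + ((G.succ u).length + (G.pred u).length + 3) ≤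
      valuePotential G b val := by
  unfold valuePotential
  rw [← Finset.add_sum_erase _ _ (Finset.mem_univ u),
    ← Finset.add_sum_erase _ (fun u => room b (val u) * _) (Finset.mem_univ u)]
  have h1 : ∀ x ∈ Finset.univ.erase u, Function.update val u y x = val x := fun x hx =>
    Function.update_of_ne (Finset.ne_of_mem_erase hx) _ _
  rw [Finset.sum_congr rfl fun x hx => by rw [h1 x hx], Function.update_self]
  have h2 := Nat.mul_le_mul_right ((G.succ u).length + (G.pred u).length + 3) (room_lt b hlt hb)
  rw [add_mul, one_mul] at h2
  omega

/-- The invariant of the value iteration with values capped at `b`, started in `μ₀`; `X` records the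
pairs of nodes for which the propagation is under way. -/
structure LiftInv (G : GameGraph V) (w : V × V → ℤ) (b : ℕ) (μ₀ : V × V → ℕ∞) (X : V → V → Prop)
    (s : LiftState V) : Prop where
  val : ∀ u, s.val u = nodeVal G s.μ u
  cnt : ∀ u, u ∈ G.V0 → s.cnt u = nodeCnt G s.μ u
  edge : ∀ u v, (u, v) ∈ G.edges →
    v ∈ s.stack ∨ X u v ∨ cap b (ominus (s.val v) (w (u, v))) ≤ s.μ (u, v)
  bounded : ∀ e, Bounded b (s.μ e)
  le : μ₀ ≤ s.μ

/-- What one raise of an edge value does to the values and counters of the nodes. -/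
theorem lift_nodes (G : GameGraph V) (b : ℕ) (s : LiftState V) {u v : V} {x : ℕ∞}
    (hval : ∀ u, s.val u = nodeVal G s.μ u) (hcnt : ∀ u, u ∈ G.V0 → s.cnt u = nodeCnt G s.μ u)
    (hb : ∀ e, Bounded b (s.μ e)) (hE : (u, v) ∈ G.edges) (hlt : s.μ (u, v) < x) :
    (lift G s u v x).Spec fun s' t => s'.μ = Function.update s.μ (u, v) x ∧
      (∀ y, s'.val y = nodeVal G s'.μ y) ∧ (∀ y, y ∈ G.V0 → s'.cnt y = nodeCnt G s'.μ y) ∧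
      (∀ y ∈ s.stack, y ∈ s'.stack) ∧ (∀ y, s'.val y = s.val y ∨ y ∈ s'.stack) ∧
      t + (valuePotential G b s'.val + stackPotential G s'.stack) ≤
        valuePotential G b s.val + stackPotential G s.stack := by
  obtain ⟨μ, hμ⟩ : ∃ μ, μ = Function.update s.μ (u, v) x := ⟨_, rfl⟩
  have hself : μ (u, v) = x := by rw [hμ, Function.update_self]
  have hne : ∀ y z, y ≠ u → μ (y, z) = s.μ (y, z) := fun y z hy => by
    rw [hμ, Function.update_of_ne fun h => hy (Prod.ext_iff.1 h).1]
  have hne2 : ∀ z, z ≠ v → μ (u, z) = s.μ (u, z) := fun z hz => by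
    rw [hμ, Function.update_of_ne fun h => hz (Prod.ext_iff.1 h).2]
  have hV : ∀ y, y ≠ u → nodeVal G μ y = nodeVal G s.μ y := fun y hy => by
    simp only [nodeVal, hne y _ hy]
  have hC : ∀ y, y ≠ u → nodeCnt G μ y = nodeCnt G s.μ y := fun y hy => by
    simp only [nodeCnt, hne y _ hy]
  have hvS : v ∈ (G.succ u).toFinset := by simpa using hE
  have hlt' : s.μ (u, v) < μ (u, v) := by rwa [hself]
  have hbu : Bounded b (s.val u) := by
    rw [hval]
    exact bounded_nodeVal G hb hE
  unfold lift
  dsimp only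
  rw [← hμ]
  by_cases hu : u ∈ G.V0
  · have hval0 : s.val u = (G.succ u).toFinset.inf fun v => s.μ (u, v) := by
      rw [hval, nodeVal, if_pos hu]
    have hcnt0 : s.cnt u = ((G.succ u).toFinset.filter fun v => s.μ (u, v) =
        (G.succ u).toFinset.inf fun v => s.μ (u, v)).card := by
      rw [hcnt u hu, nodeCnt, if_pos hu]
    have hfilter := filter_eq_inf_update (S := (G.succ u).toFinset) (f := fun v => s.μ (u, v))
      (f' := fun v => μ (u, v)) hvS hlt' hne2
    have stay : ¬ (s.μ (u, v) = s.val u ∧ s.cnt u = 1) →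
        nodeVal G μ u = s.val u ∧ nodeCnt G μ u =
          (((G.succ u).toFinset.filter fun v => s.μ (u, v) =
            (G.succ u).toFinset.inf fun v => s.μ (u, v)).erase v).card := by
      intro h
      rw [hval0, hcnt0] at h
      have := inf_eq_inf_of_not_unique (S := (G.succ u).toFinset) (f := fun v => s.μ (u, v))
        (f' := fun v => μ (u, v)) hvS h hlt' hne2
      rw [nodeVal, if_pos hu, nodeCnt, if_pos hu, this, hfilter, hval0]
      exact ⟨rfl, rfl⟩
    rw [if_pos hu]
    by_cases hmin : s.μ (u, v) = s.val u
    · rw [if_pos hmin]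
      by_cases h1 : s.cnt u = 1
      · rw [if_pos h1]
        refine Comp.Spec.bind (Comp.Spec.of_run (evalNode_run G μ u)) ?_
        rintro r t ⟨rfl, rfl⟩
        refine Comp.Spec.pure ⟨rfl, ?_, ?_, ?_, ?_, ?_⟩
        · intro y
          by_cases hy : y = u
          · subst hy
            simp
          · simp [hy, hV y hy, hval]
        · intro y hy0
          by_cases hy : y = u
          · subst hy
            simp
          · simp [hy, hC y hy, hcnt y hy0]
        · exact fun y hy => List.mem_cons_of_mem _ hy
        · intro y
          by_cases hy : y = u
          · exact Or.inr (by simp [hy])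
          · exact Or.inl (by simp [hy])
        · have hgt : s.val u < nodeVal G μ u := by
            rw [hval0, nodeVal, if_pos hu]
            exact inf_lt_inf_of_unique (f := fun v => s.μ (u, v)) (f' := fun v => μ (u, v)) hvS
              (hmin.trans hval0) (hcnt0.symm.trans h1) hlt' hne2
          have := valuePotential_update G b hgt hbu
          simp only [stackPotential, List.map_cons, List.sum_cons]
          omega
      · rw [if_neg h1]
        obtain ⟨hs1, hs2⟩ := stay fun h => h1 h.2
        have hv' : v ∈ (G.succ u).toFinset.filter fun v => s.μ (u, v) =
            (G.succ u).toFinset.inf fun v => s.μ (u, v) := by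
          rw [Finset.mem_filter]
          exact ⟨hvS, hmin.trans hval0⟩
        rw [Finset.card_erase_of_mem hv', ← hcnt0] at hs2
        refine Comp.Spec.pure ⟨rfl, ?_, ?_, fun y hy => hy, fun y => Or.inl rfl, by simp⟩
        · intro y
          by_cases hy : y = u
          · subst hy
            exact hs1.symm
          · exact (hval y).trans (hV y hy).symm
        · intro y hy0
          by_cases hy : y = u
          · subst hy
            simp [hs2]
          · simp [hy, hC y hy, hcnt y hy0]
    · rw [if_neg hmin]
      obtain ⟨hs1, hs2⟩ := stay fun h => hmin h.1
      rw [Finset.erase_eq_of_notMem, ← hcnt0] at hs2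
      · refine Comp.Spec.pure ⟨rfl, ?_, ?_, fun y hy => hy, fun y => Or.inl rfl, by simp⟩
        · intro y
          by_cases hy : y = u
          · subst hy
            exact hs1.symm
          · exact (hval y).trans (hV y hy).symm
        · intro y hy0
          by_cases hy : y = u
          · subst hy
            exact hs2.symm
          · exact (hcnt y hy0).trans (hC y hy).symm
      · intro h
        rw [Finset.mem_filter] at h
        exact hmin (h.2.trans hval0.symm)
  · have hval1 : s.val u = (G.succ u).toFinset.sup fun v => s.μ (u, v) := by
      rw [hval, nodeVal, if_neg hu]
    have hsup : nodeVal G μ u = s.val u ⊔ x := by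
      rw [nodeVal, if_neg hu, hval1]
      refine le_antisymm (Finset.sup_le fun y hy => ?_) (sup_le (Finset.sup_mono_fun fun y _ => ?_) ?_)
      · by_cases hyv : y = v
        · rw [hyv, hself]
          exact le_sup_right
        · rw [hne2 y hyv]
          exact le_sup_of_le_left (Finset.le_sup (f := fun v => s.μ (u, v)) hy)
      · by_cases hyv : y = v
        · rw [hyv]
          exact hlt'.le
        · rw [hne2 y hyv]
      · rw [← hself]
        exact Finset.le_sup (f := fun v => μ (u, v)) hvS
    have hcnt' : ∀ y, y ∈ G.V0 → s.cnt y = nodeCnt G μ y := fun y hy => by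
      rw [hC y fun h => hu (h ▸ hy), hcnt y hy]
    rw [if_neg hu]
    by_cases hx : s.val u < x
    · rw [if_pos hx]
      refine Comp.Spec.pure ⟨rfl, ?_, hcnt', fun y hy => List.mem_cons_of_mem _ hy, ?_, ?_⟩
      · intro y
        by_cases hy : y = u
        · subst hy
          rw [hsup, sup_eq_right.2 hx.le]
          simp
        · simp [hy, hV y hy, hval]
      · intro y
        by_cases hy : y = u
        · exact Or.inr (by simp [hy])
        · exact Or.inl (by simp [hy])
      · have := valuePotential_update G b hx hbu
        simp only [stackPotential, List.map_cons, List.sum_cons]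
        omega
    · rw [if_neg hx]
      refine Comp.Spec.pure ⟨rfl, ?_, hcnt', fun y hy => hy, fun y => Or.inl rfl, by simp⟩
      intro y
      by_cases hy : y = u
      · subst hy
        rw [hsup, sup_eq_left.2 (not_lt.1 hx)]
      · exact (hval y).trans (hV y hy).symm

/-- The round of the value iteration that propagates the value of `v`. -/
theorem fixPoint_round (G : GameGraph V) (w : V × V → ℤ) (b : ℕ) (μ₀ : V × V → ℕ∞) (v : V)
    (s : LiftState V) (hs : LiftInv G w b μ₀ (fun _ y => y = v) s) :
    (forEach (G.pred v) s fun s u =>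
      let x := cap b (ominus (s.val v) (w (u, v)))
      if s.μ (u, v) < x then lift G s u v x else pure s).Spec fun s' t =>
        LiftInv G w b μ₀ (fun _ _ => False) s' ∧
          t + (valuePotential G b s'.val + stackPotential G s'.stack) ≤
            valuePotential G b s.val + stackPotential G s.stack + (G.pred v).length + 1 := by
  have hs0 : LiftInv G w b μ₀ (fun u y => y = v ∧ u ∈ G.pred v) s := by
    refine ⟨hs.val, hs.cnt, fun u y hE => ?_, hs.bounded, hs.le⟩
    rcases hs.edge u y hE with h | h | h
    · exact Or.inl h
    · subst h
      exact Or.inr (Or.inl ⟨rfl, G.mem_pred.2 hE⟩)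
    · exact Or.inr (Or.inr h)
  have main := forEach_spec (body := fun (s : LiftState V) u =>
      let x := cap b (ominus (s.val v) (w (u, v)))
      if s.μ (u, v) < x then lift G s u v x else pure s)
    (fun l s => LiftInv G w b μ₀ (fun u y => y = v ∧ u ∈ l) s ∧ ∀ u ∈ l, (u, v) ∈ G.edges)
    (fun s => valuePotential G b s.val + stackPotential G s.stack) (fun _ => 0) ?_
    (G.pred v) s ⟨hs0, fun u hu => G.mem_pred.1 hu⟩
  · refine main.mono fun s' t h => ⟨⟨h.1.1.val, h.1.1.cnt, fun u y hE => ?_, h.1.1.bounded,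
      h.1.1.le⟩, by simpa using h.2⟩
    simpa using h.1.1.edge u y hE
  clear hs hs0 s
  rintro u l s ⟨hs, hl⟩
  have hE : (u, v) ∈ G.edges := hl u List.mem_cons_self
  have hl' : ∀ u ∈ l, (u, v) ∈ G.edges := fun y hy => hl y (List.mem_cons_of_mem _ hy)
  dsimp only
  by_cases hlt : s.μ (u, v) < cap b (ominus (s.val v) (w (u, v)))
  · rw [if_pos hlt]
    refine (lift_nodes G b s hs.val hs.cnt hs.bounded hE hlt).mono ?_
    rintro s' t ⟨hμ, hval, hcnt, hst, hvs, ht⟩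
    have hle : s.μ ≤ s'.μ := by
      rw [hμ, le_update_iff]
      exact ⟨hlt.le, fun _ _ => le_rfl⟩
    refine ⟨⟨⟨hval, hcnt, ?_, ?_, hs.le.trans hle⟩, hl'⟩, by simpa using ht⟩
    · intro y z hyz
      rcases hvs z with hz | hz
      · rcases hs.edge y z hyz with h | ⟨h, h'⟩ | h
        · exact Or.inl (hst z h)
        · rcases List.mem_cons.1 h' with rfl | h'
          · subst h
            refine Or.inr (Or.inr ?_)
            rw [hz, hμ, Function.update_self]
          · exact Or.inr (Or.inl ⟨h, h'⟩)
        · refine Or.inr (Or.inr ?_)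
          rw [hz]
          exact h.trans (hle _)
      · exact Or.inl hz
    · intro e
      rw [hμ]
      by_cases he : e = (u, v)
      · rw [he, Function.update_self]
        exact bounded_cap ..
      · rw [Function.update_of_ne he]
        exact hs.bounded e
  · rw [if_neg hlt]
    refine Comp.Spec.pure ⟨⟨⟨hs.val, hs.cnt, ?_, hs.bounded, hs.le⟩, hl'⟩, by simp⟩
    intro y z hyz
    rcases hs.edge y z hyz with h | ⟨h, h'⟩ | h
    · exact Or.inl h
    · rcases List.mem_cons.1 h' with rfl | h'
      · subst h
        exact Or.inr (Or.inr (not_lt.1 hlt))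
      · exact Or.inr (Or.inl ⟨h, h'⟩)
    · exact Or.inr (Or.inr h)

/-- The edge function `μ` cannot be raised any more. -/
structure IsStable (G : GameGraph V) (w : V × V → ℤ) (b : ℕ) (μ : V × V → ℕ∞) : Prop where
  edge : ∀ u v, (u, v) ∈ G.edges → cap b (ominus (nodeVal G μ v) (w (u, v))) ≤ μ (u, v)
  bounded : ∀ e, Bounded b (μ e)

theorem fixPoint_spec (G : GameGraph V) (w : V × V → ℤ) (W : ℕ) (μ₀ : V × V → ℕ∞)
    (hμ₀ : ∀ e, Bounded (Fintype.card V * W) (μ₀ e)) :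
    (fixPoint G w W μ₀).Spec fun μ t => IsStable G w (Fintype.card V * W) μ ∧ μ₀ ≤ μ ∧
      t + valuePotential G (Fintype.card V * W) (nodeVal G μ) ≤
        valuePotential G (Fintype.card V * W) (nodeVal G μ₀) +
          (2 * G.edges.card + 5 * Fintype.card V + 2) := by
  rw [fixPoint]
  have hstart := forEach_spec (body := fun (s : LiftState V) u => (do
      let r ← evalNode G s.μ u
      return { s with
        val := Function.update s.val u r.1
        cnt := Function.update s.cnt u r.2
        stack := u :: s.stack }))
    (fun l s => s.μ = μ₀ ∧ ∀ u, u ∉ l → s.val u = nodeVal G μ₀ u ∧ s.cnt u = nodeCnt G μ₀ u ∧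
      u ∈ s.stack)
    (fun s => stackPotential G s.stack)
    (fun u => (G.succ u).length + 1 + ((G.pred u).length + 2)) ?_ (nodes V)
    ⟨μ₀, fun _ => 0, fun _ => 0, []⟩ ⟨rfl, fun u hu => absurd (mem_nodes u) hu⟩
  · refine Comp.Spec.bind hstart ?_
    rintro s t1 ⟨⟨hsμ, hsu⟩, ht1⟩
    have hinv : LiftInv G w (Fintype.card V * W) μ₀ (fun _ _ => False) s := by
      refine ⟨fun u => ?_, fun u _ => ?_, fun u v _ => Or.inl (hsu v (by simp)).2.2, ?_, ?_⟩
      · rw [hsμ]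
        exact (hsu u (by simp)).1
      · rw [hsμ]
        exact (hsu u (by simp)).2.1
      · rw [hsμ]
        exact hμ₀
      · rw [hsμ]
    have hloop := whileLoop_spec (c := fun s : LiftState V => !s.stack.isEmpty)
      (body := fun s => match s.stack with
      | [] => pure s
      | v :: rest => forEach (G.pred v) { s with stack := rest } fun s u =>
          let x := cap (Fintype.card V * W) (ominus (s.val v) (w (u, v)))
          if s.μ (u, v) < x then lift G s u v x else pure s)
      (LiftInv G w (Fintype.card V * W) μ₀ (fun _ _ => False))
      (fun s => valuePotential G (Fintype.card V * W) s.val + stackPotential G s.stack) ?_ s hinv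
    · refine Comp.Spec.bind hloop ?_
      rintro s' t2 ⟨hs', hemp, ht2⟩
      have hemp : s'.stack = [] := by simpa using hemp
      have hv : s'.val = nodeVal G s'.μ := funext hs'.val
      have hv0 : s.val = nodeVal G μ₀ := funext fun u => (hsu u (by simp)).1
      refine Comp.Spec.pure ⟨⟨fun u v hE => ?_, hs'.bounded⟩, hs'.le, ?_⟩
      · have := hs'.edge u v hE
        simpa [hemp, hv] using this
      · rw [hemp, hv, hv0] at ht2
        rw [sum_nodes, length_nodes, Finset.sum_add_distrib, Finset.sum_add_distrib,
          Finset.sum_add_distrib, G.sum_length_succ, G.sum_length_pred] at ht1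
        simp only [stackPotential, List.map_nil, List.sum_nil, Finset.sum_const, Finset.card_univ,
          smul_eq_mul] at ht1 ht2
        omega
    · intro s hs hne
      obtain ⟨μ, val, cnt, stack⟩ := s
      cases stack with
      | nil => simp at hne
      | cons v rest =>
        have := fixPoint_round G w (Fintype.card V * W) μ₀ v ⟨μ, val, cnt, rest⟩
          ⟨hs.val, hs.cnt, fun u y hE => by
            have := hs.edge u y hE
            simp only [List.mem_cons] at this
            tauto, hs.bounded, hs.le⟩
        refine this.mono fun s' t h => ⟨h.1, ?_⟩
        have h2 := h.2
        simp only [stackPotential, List.map_cons, List.sum_cons] at h2 ⊢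
        omega
  · rintro u l s ⟨hμ, hs⟩
    refine Comp.Spec.bind (Comp.Spec.of_run (evalNode_run G s.μ u)) ?_
    rintro r t ⟨rfl, rfl⟩
    refine Comp.Spec.pure ⟨⟨hμ, fun y hy => ?_⟩, ?_⟩
    · by_cases hyu : y = u
      · subst hyu
        simp [hμ]
      · simpa [hyu] using hs y (by simp [hyu, hy])
    · simp only [stackPotential, List.map_cons, List.sum_cons]
      omega

theorem nodeVal_ne_top (G : GameGraph V) (μ : V × V → ℕ∞) (v : V) : nodeVal G μ v ≠ ⊤ ↔
    (v ∈ G.V0 → ∃ u ∈ G.succ v, μ (v, u) ≠ ⊤) ∧ (v ∉ G.V0 → ∀ u ∈ G.succ v, μ (v, u) ≠ ⊤) := by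
  unfold nodeVal
  split_ifs with hv
  · simp [hv, Finset.inf_eq_top_iff]
  · rw [← lt_top_iff_ne_top, Finset.sup_lt_iff (by simp)]
    simp [hv, lt_top_iff_ne_top]

theorem computeQaSTel_spec (G : GameGraph V) (w : V × V → ℤ) (W : ℕ) (μ₀ : V × V → ℕ∞)
    (hμ₀ : ∀ e, Bounded (Fintype.card V * W) (μ₀ e)) :
    (computeQaSTel G w W μ₀).Spec fun r t => IsStable G w (Fintype.card V * W) r.2 ∧ μ₀ ≤ r.2 ∧
      (∀ v, v ∈ r.1 ↔ nodeVal G r.2 v ≠ ⊤) ∧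
      t + valuePotential G (Fintype.card V * W) (nodeVal G r.2) ≤
        valuePotential G (Fintype.card V * W) (nodeVal G μ₀) +
          (3 * G.edges.card + 7 * Fintype.card V + 3) := by
  rw [computeQaSTel]
  refine Comp.Spec.bind (fixPoint_spec G w W μ₀ hμ₀) ?_
  rintro μ t1 ⟨h1, h2, ht1⟩
  have inner : ∀ (v : V) (l : List V) (r : Bool × Bool),
      l.foldl (fun r u => (r.1 || decide (μ (v, u) ≠ ⊤), r.2 && decide (μ (v, u) ≠ ⊤))) r =
        (r.1 || decide (∃ u ∈ l, μ (v, u) ≠ ⊤), r.2 && decide (∀ u ∈ l, μ (v, u) ≠ ⊤)) := by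
    intro v l
    induction l with
    | nil => simp
    | cons a l ih =>
      intro r
      rw [List.foldl_cons, ih]
      by_cases h1 : μ (v, a) = ⊤ <;> simp [h1]
  have hloop := forEach_spec (body := fun (A : Finset V) v => (do
      let r ← forEach (G.succ v) (false, true) fun r u =>
        pure (r.1 || decide (μ (v, u) ≠ ⊤), r.2 && decide (μ (v, u) ≠ ⊤))
      return if (if v ∈ G.V0 then r.1 else r.2) then insert v A else A))
    (fun l A => l.Nodup ∧ ∀ v, v ∈ A ↔ v ∉ l ∧ nodeVal G μ v ≠ ⊤) (fun _ => 0)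
    (fun v => (G.succ v).length + 1) ?_ (nodes V) ∅ ⟨nodup_nodes, by simp [mem_nodes]⟩
  · refine Comp.Spec.bind hloop ?_
    rintro A t2 ⟨⟨-, hA⟩, ht2⟩
    refine Comp.Spec.pure ⟨h1, h2, fun v => by simpa using hA v, ?_⟩
    rw [sum_nodes, length_nodes, Finset.sum_add_distrib, G.sum_length_succ] at ht2
    simp only [Finset.sum_const, Finset.card_univ, smul_eq_mul] at ht2
    simp only
    omega
  · rintro v l A ⟨hl, hA⟩
    obtain ⟨hvl, hl⟩ := List.nodup_cons.1 hl
    refine Comp.Spec.bind (Comp.Spec.of_run (forEach_pure_run _ _ _)) ?_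
    rintro r t ⟨hr, rfl⟩
    rw [inner] at hr
    refine Comp.Spec.pure ⟨⟨hl, fun y => ?_⟩, by simp⟩
    have hcond : (if v ∈ G.V0 then r.1 else r.2) = true ↔ nodeVal G μ v ≠ ⊤ := by
      rw [hr, nodeVal_ne_top]
      by_cases hv : v ∈ G.V0 <;> simp [hv]
    by_cases hc : (if v ∈ G.V0 then r.1 else r.2) = true
    · rw [if_pos hc]
      have := hcond.1 hc
      by_cases hy : y = v
      · subst hy
        simp [hvl, this]
      · simp [hy, hA]
    · rw [if_neg hc]
      have := mt hcond.2 hc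
      by_cases hy : y = v
      · subst hy
        simp [hA, not_not.1 this]
      · simp [hy, hA]

/-! ## Conflicts and the main loop -/

/-- The least value of the outgoing edges of a node. -/
noncomputable def minVal (G : GameGraph V) (μ : V × V → ℕ∞) (v : V) : ℕ∞ :=
  (G.succ v).toFinset.inf fun u => μ (v, u)

/-- All outgoing edges of least value are unsafe or co-live. -/
def Conflicting (G : GameGraph V) (F : Finset (V × V)) (μ : V × V → ℕ∞) (v : V) : Prop :=
  ∀ u, (v, u) ∈ G.edges → μ (v, u) = minVal G μ v → (v, u) ∈ F

theorem exists_minVal (G : GameGraph V) (μ : V × V → ℕ∞) {v x : V} (hE : (v, x) ∈ G.edges) :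
    ∃ u, (v, u) ∈ G.edges ∧ μ (v, u) = minVal G μ v := by
  obtain ⟨u, hu, h⟩ := Finset.exists_mem_eq_inf (G.succ v).toFinset ⟨x, by simpa using hE⟩
    fun u => μ (v, u)
  exact ⟨u, by simpa using hu, h.symm⟩

/-- The conflict list `C` for the joint winning region `R`. -/
structure IsConflicts (G : GameGraph V) (R : Finset V) (F : Finset (V × V)) (μ : V × V → ℕ∞)
    (C : List (V × V)) : Prop where
  length_le : C.length ≤ G.edges.card
  mem : ∀ e ∈ C, e ∈ G.edges ∧ e.1 ∈ R ∧ μ e = minVal G μ e.1 ∧ Conflicting G F μ e.1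
  nil : C = [] → ∀ v ∈ R, ¬ Conflicting G F μ v

theorem conflicts_spec (G : GameGraph V) (hG : ∀ v : V, ∃ v' : V, (v, v') ∈ G.edges) (R : Finset V)
    (S D : Finset (V × V)) (μ : V × V → ℕ∞) :
    (conflicts G R S D μ).Spec fun C t => IsConflicts G R (S ∪ D) μ C ∧
      t ≤ 3 * G.edges.card + 4 * Fintype.card V + 1 := by
  have hmin : ∀ (v : V) (l : List V) (x : ℕ∞), l.foldl (fun x u => min x (μ (v, u))) x =
      x ⊓ l.toFinset.inf fun u => μ (v, u) := by
    intro v l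
    induction l with
    | nil => simp
    | cons a l ih =>
      intro x
      rw [List.foldl_cons, ih, List.toFinset_cons, Finset.inf_insert, inf_assoc]
  have hbad : ∀ (v : V) (x : ℕ∞) (l : List V) (b : Bool),
      l.foldl (fun b u => b && decide (μ (v, u) = x → (v, u) ∈ S ∨ (v, u) ∈ D)) b = true ↔
        b = true ∧ ∀ u ∈ l, μ (v, u) = x → (v, u) ∈ S ∪ D := by
    intro v x l
    induction l with
    | nil => simp
    | cons a l ih =>
      intro b
      rw [List.foldl_cons, ih]
      simp only [Bool.and_eq_true, decide_eq_true_eq, List.forall_mem_cons, Finset.mem_union]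
      tauto
  have hcollect : ∀ (v : V) (x : ℕ∞) (l : List V) (C : List (V × V)),
      (l.foldl (fun C u => if μ (v, u) = x then (v, u) :: C else C) C).length ≤
        C.length + l.length ∧
      ∀ e, e ∈ l.foldl (fun C u => if μ (v, u) = x then (v, u) :: C else C) C ↔
        e ∈ C ∨ (e.1 = v ∧ e.2 ∈ l ∧ μ e = x) := by
    intro v x l
    induction l with
    | nil => simp
    | cons a l ih =>
      intro C
      rw [List.foldl_cons]
      obtain ⟨h1, h2⟩ := ih (if μ (v, a) = x then (v, a) :: C else C)
      refine ⟨h1.trans ?_, ?_⟩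
      · split_ifs
        · simp
          omega
        · simp
      · rintro ⟨y, z⟩
        rw [h2]
        by_cases ha : μ (v, a) = x
        · rw [if_pos ha]
          simp only [List.mem_cons, Prod.mk.injEq]
          grind
        · rw [if_neg ha]
          simp only [List.mem_cons]
          grind
  have hloop := forEach_spec (body := fun (C : List (V × V)) v =>
      if v ∈ R then do
        let x ← forEach (G.succ v) (⊤ : ℕ∞) fun x u => pure (min x (μ (v, u)))
        let bad ← forEach (G.succ v) true fun b u =>
          pure (b && decide (μ (v, u) = x → (v, u) ∈ S ∨ (v, u) ∈ D))
        if bad then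
          forEach (G.succ v) C fun C u => pure (if μ (v, u) = x then (v, u) :: C else C)
        else pure C
      else pure C)
    (fun l C => C.length + (l.map fun v => (G.succ v).length).sum ≤ G.edges.card ∧
      (∀ e ∈ C, e ∈ G.edges ∧ e.1 ∈ R ∧ μ e = minVal G μ e.1 ∧ Conflicting G (S ∪ D) μ e.1) ∧
      ∀ v ∈ R, v ∉ l → Conflicting G (S ∪ D) μ v → C ≠ [])
    (fun _ => 0) (fun v => 3 * ((G.succ v).length + 1)) ?_ (nodes V) []
    ⟨by simp [sum_nodes, G.sum_length_succ], by simp, fun v _ hv => absurd (mem_nodes v) hv⟩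
  · refine Comp.Spec.mono hloop ?_
    rintro C t ⟨⟨h1, h2, h3⟩, ht⟩
    refine ⟨⟨by simpa using h1, h2, fun hC v hv hc => h3 v hv (by simp) hc hC⟩, ?_⟩
    rw [sum_nodes, length_nodes, ← Finset.mul_sum, Finset.sum_add_distrib, G.sum_length_succ] at ht
    simp only [Finset.sum_const, Finset.card_univ, smul_eq_mul] at ht
    omega
  · rintro v l C ⟨h1, h2, h3⟩
    simp only [List.map_cons, List.sum_cons] at h1
    by_cases hv : v ∈ R
    · rw [if_pos hv]
      refine Comp.Spec.bind (Comp.Spec.of_run (forEach_pure_run _ _ _)) ?_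
      rintro x t1 ⟨hx, rfl⟩
      have hx : x = minVal G μ v := by
        rw [hx, hmin, top_inf_eq, minVal]
      subst hx
      refine Comp.Spec.bind (Comp.Spec.of_run (forEach_pure_run _ _ _)) ?_
      rintro bad t2 ⟨hb, rfl⟩
      have hb' : bad = true ↔ Conflicting G (S ∪ D) μ v := by
        rw [hb, hbad, Conflicting]
        simp
      by_cases hc : bad = true
      · rw [if_pos hc]
        refine (Comp.Spec.of_run (forEach_pure_run _ _ _)).mono ?_
        rintro C' t3 ⟨rfl, rfl⟩
        obtain ⟨hlen, hmem⟩ := hcollect v (minVal G μ v) (G.succ v) C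
        refine ⟨⟨by omega, ?_, ?_⟩, by omega⟩
        · intro e he
          rcases (hmem e).1 he with he | ⟨rfl, he2, he3⟩
          · exact h2 e he
          · exact ⟨G.mem_succ.1 he2, hv, he3, hb'.1 hc⟩
        · intro y hy hyl hcy
          by_cases hyv : y = v
          · subst hyv
            obtain ⟨u, hu, hμ⟩ := exists_minVal G μ (hG y).choose_spec
            exact List.ne_nil_of_mem ((hmem (y, u)).2 (Or.inr ⟨rfl, G.mem_succ.2 hu, hμ⟩))
          · obtain ⟨e, he⟩ := List.exists_mem_of_ne_nil _ (h3 y hy (by simp [hyv, hyl]) hcy)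
            exact List.ne_nil_of_mem ((hmem e).2 (Or.inl he))
      · rw [if_neg hc]
        refine Comp.Spec.pure ⟨⟨by omega, h2, fun y hy hyl hcy => ?_⟩, by omega⟩
        by_cases hyv : y = v
        · subst hyv
          exact absurd (hb'.2 hcy) hc
        · exact h3 y hy (by simp [hyv, hyl]) hcy
    · rw [if_neg hv]
      refine Comp.Spec.pure ⟨⟨by omega, h2, fun y hy hyl hcy => ?_⟩, by omega⟩
      have hyv : y ≠ v := fun h => hv (h ▸ hy)
      exact h3 y hy (by simp [hyv, hyl]) hcy

/-- The invariant of the main loop. -/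
structure MainInv (G : GameGraph V) (w : V × V → ℤ) (W : ℕ) (T : Finset V) (s : MainState V) :
    Prop where
  temp : IsTemplate G T s.qual
  stable : IsStable G w (Fintype.card V * W) s.μ
  region : ∀ v, v ∈ s.region ↔ v ∈ s.qual.region ∧ nodeVal G s.μ v ≠ ⊤
  conf : IsConflicts G s.region (s.qual.S ∪ s.qual.D) s.μ s.conf

/-- The conflicting edges have finite values. -/
theorem MainInv.conf_ne_top {G : GameGraph V} {w : V × V → ℤ} {W : ℕ} {T : Finset V}
    {s : MainState V} (h : MainInv G w W T s) {e : V × V} (he : e ∈ s.conf) :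
    e ∈ G.edges ∧ s.μ e ≠ ⊤ := by
  obtain ⟨h1, h2, h3, h4⟩ := h.conf.mem e he
  have h0 : e.1 ∈ G.V0 := by
    rcases Finset.mem_union.1 (h4 e.2 h1 h3) with h' | h'
    · exact ((h.temp.mem_S _ _).1 h').2.1
    · exact (h.temp.mem_D _ _ h').2.1
  refine ⟨h1, ?_⟩
  rw [h3, minVal]
  have := ((h.region _).1 h2).2
  rwa [nodeVal, if_pos h0] at this

theorem findConf_spec (G : GameGraph V) (hG : ∀ v : V, ∃ v' : V, (v, v') ∈ G.edges)
    (w : V × V → ℤ) (W : ℕ) (T safe : Finset V) (Q : QualTemplate V) (hQ : IsTemplate G T Q)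
    (μ₀ : V × V → ℕ∞) (hμ₀ : ∀ e, Bounded (Fintype.card V * W) (μ₀ e)) :
    (findConf G w W safe Q μ₀).Spec fun s t => MainInv G w W T s ∧ s.safe = safe ∧ μ₀ ≤ s.μ ∧
      t + valuePotential G (Fintype.card V * W) (nodeVal G s.μ) ≤
        valuePotential G (Fintype.card V * W) (nodeVal G μ₀) +
          (6 * G.edges.card + 12 * Fintype.card V + 5) := by
  rw [findConf]
  refine Comp.Spec.bind (computeQaSTel_spec G w W μ₀ hμ₀) ?_
  rintro ⟨A, μ⟩ t1 ⟨h1, h2, h3, ht1⟩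
  refine Comp.Spec.bind (Comp.Spec.of_run (nodesWhere_run _)) ?_
  rintro R t2 ⟨hR, rfl⟩
  refine Comp.Spec.bind (conflicts_spec G hG R Q.S Q.D μ) ?_
  rintro C t3 ⟨hC, ht3⟩
  refine Comp.Spec.pure ⟨⟨hQ, h1, fun v => ?_, hC⟩, rfl, h2, ?_⟩
  · simp only at h3 ⊢
    rw [hR, ← h3]
    simp
  · simp only at ht1 ⊢
    omega

/-- The number of edges of finite value. -/
noncomputable def finiteCard (G : GameGraph V) (μ : V × V → ℕ∞) : ℕ :=
  (G.edges.filter fun e => μ e ≠ ⊤).card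

/-- The potential of the main loop. -/
noncomputable def mainPotential (G : GameGraph V) (W : ℕ) (s : MainState V) : ℕ :=
  (7 * G.edges.card + 13 * Fintype.card V + 8) * finiteCard G s.μ +
  ((10 * G.edges.card + 30 * Fintype.card V + 25) * (Fintype.card V + 1)) * s.safe.card +
  valuePotential G (Fintype.card V * W) (nodeVal G s.μ)

theorem foldl_update_top {V : Type} [LinearOrder V] (l : List (V × V)) (μ : V × V → ℕ∞) (e : V × V) :
    l.foldl (fun (μ : V × V → ℕ∞) e => Function.update μ e ⊤) μ e = if e ∈ l then ⊤ else μ e := by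
  induction l generalizing μ with
  | nil => simp
  | cons a l ih =>
    rw [List.foldl_cons, ih]
    by_cases h1 : e ∈ l
    · simp [h1]
    · by_cases h2 : e = a
      · simp [h2]
      · simp [h1, h2]

theorem main_round (G : GameGraph V) (hG : ∀ v : V, ∃ v' : V, (v, v') ∈ G.edges)
    (w : V × V → ℤ) (W : ℕ) (T : Finset V) (s : MainState V) (hs : MainInv G w W T s)
    (hne : s.conf ≠ []) :
    (do
      let μ ← forEach s.conf s.μ fun μ e => pure (Function.update μ e ⊤)
      let dropped ← nodesWhere fun v => v ∈ s.safe ∧ v ∉ s.region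
      if dropped = ∅ then
        findConf G w W s.safe s.qual μ
      else do
        let safe ← nodesWhere fun v => v ∈ s.safe ∧ v ∈ s.region
        let Q ← coBuchiTemp G T safe
        findConf G w W safe Q μ).Spec fun s' t => MainInv G w W T s' ∧
          t + 1 + mainPotential G W s' ≤ mainPotential G W s := by
  refine Comp.Spec.bind (Comp.Spec.of_run (forEach_pure_run _ _ _)) ?_
  rintro μ t1 ⟨hμ, rfl⟩
  have hμ' : ∀ e, μ e = if e ∈ s.conf then ⊤ else s.μ e := fun e => by
    rw [hμ, foldl_update_top]
  have hle : s.μ ≤ μ := fun e => by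
    rw [hμ']
    split_ifs
    · exact le_top
    · exact le_rfl
  have hb : ∀ e, Bounded (Fintype.card V * W) (μ e) := fun e => by
    rw [hμ']
    split_ifs
    · exact Or.inr rfl
    · exact hs.stable.bounded e
  have hpot := valuePotential_anti G (Fintype.card V * W) fun u => nodeVal_mono G hle u
  have hfin : ∀ μ' : V × V → ℕ∞, μ ≤ μ' → finiteCard G μ' + 1 ≤ finiteCard G s.μ := by
    intro μ' hμμ'
    obtain ⟨e, he⟩ := List.exists_mem_of_ne_nil _ hne
    obtain ⟨heE, hefin⟩ := hs.conf_ne_top he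
    have hetop : μ' e = ⊤ := by
      have := hμμ' e
      rw [hμ', if_pos he] at this
      exact top_le_iff.1 this
    refine Finset.card_lt_card ⟨fun x hx => ?_, fun h => ?_⟩
    · rw [Finset.mem_filter] at hx ⊢
      refine ⟨hx.1, fun h => hx.2 ?_⟩
      exact top_le_iff.1 (h ▸ (hle x).trans (hμμ' x))
    · have := Finset.mem_filter.1 (h (Finset.mem_filter.2 ⟨heE, hefin⟩))
      exact this.2 hetop
  have hlen := hs.conf.length_le
  refine Comp.Spec.bind (Comp.Spec.of_run (nodesWhere_run _)) ?_
  rintro dropped t2 ⟨hd, rfl⟩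
  by_cases hdrop : dropped = ∅
  · rw [if_pos hdrop]
    refine (findConf_spec G hG w W T s.safe s.qual hs.temp μ hb).mono ?_
    rintro s' t ⟨h1, h2, h3, h4⟩
    refine ⟨h1, ?_⟩
    have e1 := Nat.mul_le_mul_left (7 * G.edges.card + 13 * Fintype.card V + 8) (hfin _ h3)
    rw [mul_add] at e1
    simp only [mainPotential, h2]
    omega
  · rw [if_neg hdrop]
    refine Comp.Spec.bind (Comp.Spec.of_run (nodesWhere_run _)) ?_
    rintro safe t3 ⟨hsafe, rfl⟩
    refine Comp.Spec.bind (coBuchiTemp_spec G hG T safe) ?_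
    rintro Q t4 ⟨hQ, ht4⟩
    refine (findConf_spec G hG w W T safe Q hQ μ hb).mono ?_
    rintro s' t ⟨h1, h2, h3, h4⟩
    refine ⟨h1, ?_⟩
    have hcard : safe.card + 1 ≤ s.safe.card := by
      obtain ⟨x, hx⟩ := Finset.nonempty_iff_ne_empty.2 hdrop
      have hx' : x ∈ s.safe ∧ x ∉ s.region := by
        rw [hd] at hx
        simpa using hx
      refine Finset.card_lt_card ⟨fun y hy => ?_, fun h => ?_⟩
      · rw [hsafe] at hy
        simp only [Finset.mem_filter, decide_eq_true_eq] at hy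
        exact hy.2.1
      · have := h hx'.1
        rw [hsafe] at this
        simp only [Finset.mem_filter, decide_eq_true_eq] at this
        exact hx'.2 this.2.2
    have e1 := Nat.mul_le_mul_left (7 * G.edges.card + 13 * Fintype.card V + 8) (hfin _ h3)
    rw [mul_add] at e1
    have e2 := Nat.mul_le_mul_left
      ((10 * G.edges.card + 30 * Fintype.card V + 25) * (Fintype.card V + 1)) hcard
    rw [mul_add, mul_one] at e2
    have e3 : (10 * G.edges.card + 30 * Fintype.card V + 25) * (Fintype.card V + 1) =
      (10 * G.edges.card + 30 * Fintype.card V + 24) * (Fintype.card V + 1) +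
        (Fintype.card V + 1) := by ring
    simp only [mainPotential, h2]
    omega

theorem valuePotential_le (G : GameGraph V) (b : ℕ) (val : V → ℕ∞) :
    valuePotential G b val ≤ (b + 1) * (2 * G.edges.card + 3 * Fintype.card V) := by
  have : ∑ u, ((G.succ u).length + (G.pred u).length + 3) =
      2 * G.edges.card + 3 * Fintype.card V := by
    rw [Finset.sum_add_distrib, Finset.sum_add_distrib, G.sum_length_succ, G.sum_length_pred]
    simp only [Finset.sum_const, Finset.card_univ, smul_eq_mul]
    ring
  rw [← this, Finset.mul_sum]
  exact Finset.sum_le_sum fun u _ => Nat.mul_le_mul_right _ (room_le _ _)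

theorem foldl_update_zero (G : GameGraph V) (us : List V) :
    us.foldl (fun μ u => (G.succ u).foldl
      (fun (μ : V × V → ℕ∞) v => Function.update μ (u, v) 0) μ) (fun _ => 0) = fun _ => 0 := by
  have inner : ∀ (u : V) (l : List V), l.foldl
      (fun (μ : V × V → ℕ∞) v => Function.update μ (u, v) 0) (fun _ => 0) = fun _ => 0 := by
    intro u l
    induction l with
    | nil => rfl
    | cons a l ih =>
      rw [List.foldl_cons]
      have h0 := Function.update_eq_self (u, a) fun _ : V × V => (0 : ℕ∞)
      rw [h0, ih]
  induction us with
  | nil => rfl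
  | cons u us ih => rw [List.foldl_cons, inner, ih]

theorem computeMiSTel_spec [Nonempty V] (G : GameGraph V)
    (hG : ∀ v : V, ∃ v' : V, (v, v') ∈ G.edges) (w : V × V → ℤ) (W : ℕ) (T : Finset V) :
    (computeMiSTel G w W T).Spec fun r t => (∃ s, MainInv G w W T s ∧ s.conf = [] ∧
      r = (s.region, ⟨s.qual.S, s.qual.D, QaSTel.ofValue G s.μ⟩)) ∧
      t ≤ 400 * (Fintype.card V ^ 2 * G.edges.card + Fintype.card V * G.edges.card * W) := by
  rw [computeMiSTel]
  refine Comp.Spec.bind (Comp.Spec.of_run (forEach_run _ _ (fun μ u => forEach_pure_run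
    (fun (μ : V × V → ℕ∞) v => Function.update μ (u, v) 0) (G.succ u) μ) _ _)) ?_
  rintro μ₀ t1 ⟨hμ₀, ht1⟩
  rw [foldl_update_zero] at hμ₀
  subst hμ₀
  rw [length_nodes, sum_nodes, Finset.sum_add_distrib, G.sum_length_succ] at ht1
  simp only [Finset.sum_const, Finset.card_univ, smul_eq_mul, mul_one] at ht1
  refine Comp.Spec.bind (coBuchiTemp_spec G hG T Finset.univ) ?_
  rintro Q t2 ⟨hQ, ht2⟩
  refine Comp.Spec.bind (findConf_spec G hG w W T Finset.univ Q hQ (fun _ => 0)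
    fun _ => Or.inl zero_le) ?_
  rintro s t3 ⟨hs, hsafe, -, ht3⟩
  have hloop := whileLoop_spec (c := fun s : MainState V => !s.conf.isEmpty)
    (body := fun s => (do
      let μ ← forEach s.conf s.μ fun μ e => pure (Function.update μ e ⊤)
      let dropped ← nodesWhere fun v => v ∈ s.safe ∧ v ∉ s.region
      if dropped = ∅ then
        findConf G w W s.safe s.qual μ
      else do
        let safe ← nodesWhere fun v => v ∈ s.safe ∧ v ∈ s.region
        let Q ← coBuchiTemp G T safe
        findConf G w W safe Q μ)) (MainInv G w W T) (mainPotential G W)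
    (fun s hs hc => main_round G hG w W T s hs (by simpa using hc)) s hs
  refine Comp.Spec.bind hloop ?_
  rintro s' t4 ⟨hs', hc, ht4⟩
  refine Comp.Spec.pure ⟨⟨s', hs', by simpa using hc, rfl⟩, ?_⟩
  have hn := G.card_le_card_edges hG
  have hm := G.card_edges_le
  have hn1 : 1 ≤ Fintype.card V := Fintype.card_pos
  have hf : finiteCard G s.μ ≤ G.edges.card := Finset.card_filter_le _ _
  have hv := valuePotential_le G (Fintype.card V * W) (nodeVal G fun _ => 0)
  have ht5 : t4 ≤ mainPotential G W s + 1 := by omega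
  rw [mainPotential, hsafe, Finset.card_univ] at ht5
  clear ht4
  have e1 := Nat.mul_le_mul_left (7 * G.edges.card + 13 * Fintype.card V + 8) hf
  generalize Fintype.card V = n at *
  generalize G.edges.card = m at *
  have hmm : m * m ≤ n ^ 2 * m := Nat.mul_le_mul_right m hm
  have hnm : n * m ≤ n ^ 2 * m := by
    rw [sq, mul_assoc]
    exact Nat.le_mul_of_pos_left _ hn1
  have hm1 : m ≤ n * m := Nat.le_mul_of_pos_left _ hn1
  have a1 : (7 * m + 13 * n + 8) * m ≤ 28 * (m * m) := by
    rw [← mul_assoc]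
    exact Nat.mul_le_mul_right m (by omega)
  have a2 : (10 * m + 30 * n + 25) * (n + 1) ≤ 130 * (n * m) := by
    calc _ ≤ (65 * m) * (2 * n) := Nat.mul_le_mul (by omega) (by omega)
      _ = _ := by ring
  have a3 : (10 * m + 30 * n + 25) * (n + 1) * n ≤ 130 * (n ^ 2 * m) := by
    calc _ ≤ 130 * (n * m) * n := Nat.mul_le_mul_right n a2
      _ = _ := by ring
  have a4 : (n * W + 1) * (2 * m + 3 * n) ≤ 5 * (n * m * W) + 5 * m := by
    calc _ ≤ (n * W + 1) * (5 * m) := Nat.mul_le_mul_left _ (by omega)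
      _ = _ := by ring
  have a5 : (10 * m + 30 * n + 24) * (n + 1) ≤ (10 * m + 30 * n + 25) * (n + 1) :=
    Nat.mul_le_mul_right _ (by omega)
  omega

/-! ## The computed template is conflict-free and winning -/

theorem QaSTel.act_ofValue {V : Type} [DecidableEq V] (G : GameGraph V) (μ : V × V → ℕ∞)
    {e : V × V} (he : e ∈ G.edges) : (QaSTel.ofValue G μ).act e = μ e := by
  have : {k : ℕ∞ | ∀ k', k ≤ k' → e ∈ (QaSTel.ofValue G μ).active e.1 k'} = Set.Ici (μ e) := by
    ext k
    simp only [QaSTel.ofValue, Finset.mem_filter, GameGraph.out, Set.mem_ofPred_eq, Set.mem_Ici, he,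
      true_and]
    exact ⟨fun h => h k le_rfl, fun h k' hk => h.trans hk⟩
  rw [QaSTel.act, this, csInf_Ici]

theorem mem_minEdges (G : GameGraph V) (μ : V × V → ℕ∞) {v u : V} (hE : (v, u) ∈ G.edges)
    (h : μ (v, u) = minVal G μ v) : (v, u) ∈ (QaSTel.ofValue G μ).minEdges v := by
  refine ⟨by simp [GameGraph.out, hE], ?_⟩
  rintro ⟨x, y⟩ he
  obtain ⟨hxy, rfl⟩ : (x, y) ∈ G.edges ∧ x = v := by simpa [GameGraph.out] using he
  rw [QaSTel.act_ofValue G μ hE, QaSTel.act_ofValue G μ hxy, h, minVal]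
  exact Finset.inf_le (f := fun y => μ (x, y)) (by simpa using hxy)

theorem MainInv.isValid {G : GameGraph V} {w : V × V → ℤ} {W : ℕ} {T : Finset V}
    {s : MainState V} (h : MainInv G w W T s) :
    (⟨s.qual.S, s.qual.D, QaSTel.ofValue G s.μ⟩ : MiSTel G).IsValid := by
  refine ⟨?_, ?_⟩
  · rintro ⟨u, v⟩ he
    have := (h.temp.mem_S u v).1 he
    simp [GameGraph.edges0, this.1, this.2.1]
  · rintro ⟨u, v⟩ he
    have := h.temp.mem_D u v he
    simp [GameGraph.edges0, this.1, this.2.1]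

theorem MainInv.conflictFree {G : GameGraph V} (hG : ∀ v : V, ∃ v' : V, (v, v') ∈ G.edges)
    {w : V × V → ℤ} {W : ℕ} {T : Finset V} {s : MainState V} (h : MainInv G w W T s)
    (hc : s.conf = []) :
    (⟨s.qual.S, s.qual.D, QaSTel.ofValue G s.μ⟩ : MiSTel G).ConflictFree := by
  intro v hv
  have hsource : ∀ u, (v, u) ∈ s.qual.S ∪ s.qual.D → v ∈ G.V0 ∧ v ∈ s.qual.region := by
    intro u hu
    rcases Finset.mem_union.1 hu with hu | hu
    · exact ⟨((h.temp.mem_S _ _).1 hu).2.1, ((h.temp.mem_S _ _).1 hu).2.2.1⟩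
    · exact (h.temp.mem_D _ _ hu).2
  suffices ∃ u, (v, u) ∈ G.edges ∧ s.μ (v, u) = minVal G s.μ v ∧ (v, u) ∉ s.qual.S ∪ s.qual.D by
    obtain ⟨u, hE, hμ, hu⟩ := this
    exact hu (Finset.mem_coe.1 (hv (mem_minEdges G s.μ hE hμ)))
  by_cases hv' : v ∈ G.V0 ∧ v ∈ s.qual.region
  · by_cases hvR : v ∈ s.region
    · have := h.conf.nil hc v hvR
      simpa only [Conflicting, not_forall, exists_prop] using this
    · have htop : minVal G s.μ v = ⊤ := by
        have : nodeVal G s.μ v = ⊤ := by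
          by_contra h'
          exact hvR ((h.region v).2 ⟨hv'.2, h'⟩)
        rwa [nodeVal, if_pos hv'.1] at this
      obtain ⟨u, hu, hE, hD⟩ := h.temp.exists_succ v hv'.2 hv'.1
      refine ⟨u, hE, ?_, ?_⟩
      · rw [htop]
        refine top_le_iff.1 (htop ▸ ?_)
        exact Finset.inf_le (f := fun y => s.μ (v, y)) (by simpa using hE)
      · intro hu'
        rcases Finset.mem_union.1 hu' with hS | hD'
        · exact ((h.temp.mem_S _ _).1 hS).2.2.2 hu
        · exact hD hD'
  · obtain ⟨u, hE, hμ⟩ := exists_minVal G s.μ (hG v).choose_spec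
    exact ⟨u, hE, hμ, fun hu => hv' (hsource u hu)⟩

/-- Plays that respect the co-Büchi template satisfy the co-Büchi objective. -/
theorem IsTemplate.coBuchi {V : Type} [LinearOrder V] {G : GameGraph V} {T : Finset V} {Q : QualTemplate V}
    (h : IsTemplate G T Q) {ρ : ℕ → V} (hρ : G.IsPlay ρ) (h0 : ρ 0 ∈ Q.region)
    (hS : ∀ e ∈ Q.S, ∀ i, (ρ i, ρ (i + 1)) ≠ e)
    (hD : ∀ e ∈ Q.D, ¬ ∃ᶠ i in atTop, (ρ i, ρ (i + 1)) = e) : ρ ∈ coBuchi T := by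
  have hstay : ∀ i, ρ i ∈ Q.region := by
    intro i
    induction i with
    | zero => exact h0
    | succ i ih =>
      by_cases hi : ρ i ∈ G.V0
      · by_contra hno
        exact hS _ ((h.mem_S _ _).2 ⟨hρ i, hi, ih, hno⟩) i rfl
      · exact h.all_succ _ ih hi _ (hρ i)
  have hev : ∀ᶠ i in atTop, ∀ e ∈ Q.D, (ρ i, ρ (i + 1)) ≠ e :=
    (Filter.eventually_all_finset Q.D).2 fun e he => not_frequently.1 (hD e he)
  obtain ⟨N, hN⟩ := eventually_atTop.1 hev
  obtain ⟨rank, hrank⟩ := h.rank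
  have hstep : ∀ i ≥ N, rank (ρ (i + 1)) ≤ rank (ρ i) ∧
      (ρ i ∉ T → rank (ρ (i + 1)) < rank (ρ i)) := fun i hi =>
    hrank _ (hstay i) _ (hstay (i + 1)) (hρ i) fun he => hN i hi _ he rfl
  obtain ⟨j, hj⟩ : ∃ j ≥ N, ∀ i ≥ N, rank (ρ j) ≤ rank (ρ i) := by
    have hwf := WellFounded.has_min (measure fun i => rank (ρ i)).wf (Set.Ici N) ⟨N, Set.self_mem_Ici⟩
    obtain ⟨j, hj, hmin⟩ := hwf
    exact ⟨j, hj, fun i hi => not_lt.1 (hmin i hi)⟩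
  have hle : ∀ d, rank (ρ (j + d)) ≤ rank (ρ j) := by
    intro d
    induction d with
    | zero => exact le_rfl
    | succ d ih => exact (hstep (j + d) (by omega)).1.trans ih
  intro v hv
  obtain ⟨i, hi, rfl⟩ := (frequently_atTop.1 hv) j
  by_contra hT
  have h1 := (hstep i (by omega)).2 hT
  have h2 := hj.2 (i + 1) (by omega)
  have h3 := hle (i - j)
  rw [Nat.add_sub_cancel' hi] at h3
  omega

/-- An edge that is active for some finite credit leads to a node whose value is at most the credit
that remains. -/
theorem IsStable.credit {G : GameGraph V} {w : V × V → ℤ} {b : ℕ} {μ : V × V → ℕ∞}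
    (h : IsStable G w b μ) {u v : V} (hE : (u, v) ∈ G.edges) {k : ℤ} (hk : 0 ≤ k)
    (hμ : μ (u, v) ≤ (k.toNat : ℕ∞)) :
    0 ≤ k + w (u, v) ∧ nodeVal G μ v ≤ ((k + w (u, v)).toNat : ℕ∞) := by
  have h1 := (h.edge u v hE).trans hμ
  unfold cap at h1
  split_ifs at h1 with hb
  · generalize nodeVal G μ v = x at *
    have hx : x ≠ ⊤ := by
      rintro rfl
      exact ENat.natCast_ne_top _ (top_le_iff.1 h1)
    lift x to ℕ using hx
    have h2 : ((x : ℤ) - w (u, v)).toNat ≤ k.toNat := by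
      rw [ominus, ENat.map_natCast] at h1
      exact WithTop.coe_le_coe.1 h1
    have h3 : (x : ℤ) ≤ k + w (u, v) := by omega
    refine ⟨by omega, ?_⟩
    have : x ≤ (k + w (u, v)).toNat := by omega
    exact_mod_cast this
  · simp at h1

/-- Plays that follow the quantitative template keep a non-negative credit. -/
theorem IsStable.credit_nonneg {G : GameGraph V} {w : V × V → ℤ} {b c : ℕ} {μ : V × V → ℕ∞}
    (h : IsStable G w b μ) (hG : ∀ v : V, ∃ v' : V, (v, v') ∈ G.edges) (hbc : b ≤ c) {ρ : ℕ → V}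
    (h0 : nodeVal G μ (ρ 0) ≠ ⊤) (hρ : (QaSTel.ofValue G μ).IsPlay w c ρ) (i : ℕ) :
    0 ≤ c + prefixWeight w ρ i ∧ nodeVal G μ (ρ i) ≤ ((c + prefixWeight w ρ i).toNat : ℕ∞) := by
  obtain ⟨hplay, k, hk1, hk2⟩ := hρ
  induction i using Nat.strong_induction_on with
  | _ i ih =>
    cases i with
    | zero =>
      have hb := (bounded_nodeVal G h.bounded (hG (ρ 0)).choose_spec).resolve_right h0
      refine ⟨by simp [prefixWeight], hb.trans ?_⟩
      simpa [prefixWeight] using hbc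
    | succ i =>
      obtain ⟨hi1, hi2⟩ := ih i (Nat.lt_succ_self i)
      have hμ : μ (ρ i, ρ (i + 1)) ≤ ((c + prefixWeight w ρ i).toNat : ℕ∞) := by
        by_cases hi0 : ρ i ∈ G.V0
        · have hik : (i : ℕ∞) < k := by
            by_contra hik
            have hik := not_lt.1 hik
            lift k to ℕ using fun h' => by simp [h'] at hik
            have hki : k ≤ i := by exact_mod_cast hik
            obtain ⟨hj1, hj2⟩ := ih k (by omega)
            obtain ⟨hk0, hemp⟩ := hk2 k rfl
            obtain ⟨u, hE, hu⟩ := exists_minVal G μ (hG (ρ k)).choose_spec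
            rw [nodeVal, if_pos hk0] at hj2
            rw [QaSTel.activeInt, if_pos hj1] at hemp
            refine Finset.notMem_empty (ρ k, u) (hemp ▸ ?_)
            simp only [QaSTel.ofValue, Finset.mem_filter, GameGraph.out]
            exact ⟨⟨hE, trivial⟩, hu.le.trans hj2⟩
          have := hk1 i hik hi0
          rw [QaSTel.activeInt, if_pos hi1] at this
          exact (Finset.mem_filter.1 this).2
        · rw [nodeVal, if_neg hi0] at hi2
          refine le_trans ?_ hi2
          exact Finset.le_sup (f := fun y => μ (ρ i, y)) (by simpa using hplay i)
      have := h.credit (hplay i) hi1 hμ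
      rw [prefixWeight, Finset.sum_range_succ, ← add_assoc]
      exact this

theorem mem_meanPayoff_of_credit {V : Type} {w : V × V → ℤ} {ρ : ℕ → V} (c : ℕ)
    (h : ∀ i, 0 ≤ c + prefixWeight w ρ i) : ρ ∈ meanPayoff w := by
  have hlim : Tendsto (fun i : ℕ => (((-(c : ℝ)) / (i : ℝ) : ℝ) : EReal)) atTop (nhds 0) :=
    (continuous_coe_real_ereal.tendsto 0).comp (tendsto_const_div_atTop_nhds_zero_nat _)
  rw [meanPayoff, Set.mem_ofPred_eq, ← hlim.limsup_eq]
  refine limsup_le_limsup (Eventually.of_forall fun i => ?_)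
  rw [EReal.coe_le_coe_iff]
  refine div_le_div_of_nonneg_right ?_ (Nat.cast_nonneg i)
  have : (0 : ℝ) ≤ c + prefixWeight w ρ i := by exact_mod_cast h i
  linarith

theorem MainInv.winningFrom {G : GameGraph V} (hG : ∀ v : V, ∃ v' : V, (v, v') ∈ G.edges)
    {w : V × V → ℤ} {W : ℕ} {T : Finset V} {s : MainState V} (h : MainInv G w W T s) :
    (⟨s.qual.S, s.qual.D, QaSTel.ofValue G s.μ⟩ : MiSTel G).WinningFrom w W T s.region := by
  intro v hv π hPe hQa
  obtain ⟨hvZ, hvfin⟩ := (h.region v).1 hv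
  refine ⟨?_, ?_⟩
  · rintro ρ hρ rfl
    obtain ⟨c, hc, hplay⟩ := hQa
    rw [mul_comm] at hc
    exact mem_meanPayoff_of_credit c fun i =>
      (h.stable.credit_nonneg hG hc hvfin (hplay ρ hρ) i).1
  · rintro ρ hρ rfl
    exact h.temp.coBuchi hρ.1 hvZ (hPe ρ hρ).1 (hPe ρ hρ).2

end Algorithms
end MixedGame

open MixedGame
theorem mainTheorem8 :
    ∃ K : ℕ, ∀ (V : Type) [Fintype V] [LinearOrder V] [Nonempty V]
      (G : GameGraph V) (_hG : ∀ v : V, ∃ v' : V, (v, v') ∈ G.edges)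
      (w : V × V → ℤ) (W : ℕ) (_hw : ∀ e ∈ G.edges, |w e| ≤ (W : ℤ))
      (T : Finset V),
      ∃ (R : Finset V) (L : MiSTel G) (t : ℕ),
        (computeMiSTel G w W T).run = some ((R, L), t) ∧
        L.IsValid ∧ L.ConflictFree ∧ L.WinningFrom w W T R ∧
        t ≤ K * (Fintype.card V ^ 2 * G.edges.card + Fintype.card V * G.edges.card * W) := by
  refine ⟨400, fun V _ _ _ G hG w W _ T => ?_⟩
  obtain ⟨r, t, hrun, ⟨s, hs, hc, rfl⟩, ht⟩ := computeMiSTel_spec G hG w W T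
  exact ⟨_, _, t, hrun, hs.isValid, hs.conflictFree hG hc, hs.winningFrom hG, ht⟩
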